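/- Let $R$ be a commutative ring and let $D$ be the closure of a braid word on $b\ge 1$ strands, with crossing set $\mathcal X$, $n_\pm$ positive/negative crossings, and $sl=-b+n_+-n_-$. **The complex.** For $\alpha:\mathcal X\to\{0,1\}$ with $|\alpha|=\sum_x\alpha(x)$, let $V_\alpha$ be the free $R$-module on the circles of the resolution of $D$ in which each crossing $x$ is replaced by its $\alpha(x)$-smoothing; the 0-smoothing of a positive crossing and the 1-smoothing of a negative crossing are the oriented ones (two parallel strands). Choose an arrow at every crossing, joining the two arcs of the 0-smoothing; rotated clockwise by $90^\circ$ it joins the two arcs of the 1-smoothing. An edge of the cube of resolutions carries the map of exterior algebras that identifies the generators of two merging circles, or, if it splits a circle into $a_0$ and $a_1$ with the rotated arrow pointing from $a_0$ to $a_1$, the map $\omega\mapsto (v_{a_0}-v_{a_1})\wedge\omega$. Choose a sign for every edge, such that all faces of the cube anticommute and every face of type X (resp. Y) has an even (resp. odd) number of negative edges. Here a face is of type X or Y if each of its two arrows splits one and the same circle and, after either split, the other arrow joins the two new circles; it is of type X if after one split the other arrow starts on the circle at which the rotated first arrow ends, and of type Y if it starts on the circle at which the rotated first arrow starts. The odd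 Khovanov complex is $C(D)=\bigoplus_\alpha\Lambda^*V_\alpha$ with the sum $d$ of the signed edge maps; $\Lambda^kV_\alpha$ has bidegree $(r,Q)$ with $r=|\alpha|-n_-$ and $Q=\operatorname{rank}V_\alpha-2k+n_+-2n_-+|\alpha|$. Its homology is $Kh'_{r,Q}(D)$. **The reduced complex.** Let $\varphi_\alpha:V_\alpha\to R$ be the sum of coefficients. The reduced complex is $\overline C(D)=\bigoplus_\alpha\Lambda^*(\ker\varphi_\alpha)\subset C(D)$, where $\Lambda^k(\ker\varphi_\alpha)$ has bidegree $r=|\alpha|-n_-$, $Q=(\operatorname{rank}V_\alpha-1)-2k+n_+-2n_-+|\alpha|$; its homology is $\overline{Kh'}_{r,Q}(D)$. **The invariants.** Let $\alpha'$ be the resolution into $b$ parallel strands, with generators $v_1,\dots,v_b$ of $V_{\alpha'}$ in the order of the strands. Put $\psi(D)=v_1\wedge\dots\wedge v_b\in\Lambda^bV_{\alpha'}$ and $\overline\psi(D)=(v_1-v_2)\wedge\dots\wedge(v_{b-1}-v_b)\in\Lambda^{b-1}(\ker\varphi_{\alpha'})$. **The splitting.** For a point $p$ of a diagram, not at a crossing,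 let $v_p$ be the generator of the circle through $p$, let $\overline C^{(p)}(D)=v_p\wedge C(D)$, and let $X_D^p:\overline C^{(p)}(D)\to\overline C(D)$ be the $R$-linear isomorphism $\omega\wedge v_p\mapsto\omega$ ($\omega\in\overline C(D)$). Let $D\sqcup O$ be $D$ with an additional unknot $O$, with generator $v_0$; let $p\in O$ and let $q\in D$ be not at a crossing. Define $\Phi=\Phi_4\circ\Phi_3\circ\Phi_2\circ\Phi_1: C(D)\to\overline C(D)\oplus\overline C(D)$ by $$\Phi_1:C(D)\to\overline C^{(p)}(D\sqcup O),\quad \omega\mapsto\omega\wedge v_0;\qquad \Phi_2=(X_{D\sqcup O}^q)^{-1}\circ X_{D\sqcup O}^p;$$ $$\Phi_3:\overline C^{(q)}(D\sqcup O)\to\overline C^{(q)}(D)\oplus\overline C^{(q)}(D),\quad \omega\mapsto(\omega,0),\ \ \omega\wedge v_0\mapsto(0,\omega)\quad(\omega\in\overline C^{(q)}(D));\qquad \Phi_4=X_D^q\oplus X_D^q.$$ **Proposition.** One has $d^2=0$ and $d(\overline C(D))\subset\overline C(D)$, and the $R$-linear isomorphism $\Phi$ commutes with the differentials. The map $z\mapsto\Phi^{-1}(0,z)$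 takes the cycles of bidegree $(r,s+1)$ of $\overline C(D)$ to cycles of bidegree $(r,s)$ of $C(D)$ and induces injective linear maps $\overline{Kh'}_{r,s+1}(D)\hookrightarrow Kh'_{r,s}(D)$ for all $r,s\in\mathbb Z$. The elements $\overline\psi(D)$ and $\psi(D)$ are cycles of bidegree $(0,sl+1)$ and $(0,sl)$, and the inclusion $\overline{Kh'}_{0,sl+1}(D)\hookrightarrow Kh'_{0,sl}(D)$ sends the class of $\overline\psi(D)$ to the class of $\psi(D)$ or to its negative. -/

import Mathlib

noncomputable section

namespace OddKhovanov

/-! ### Exterior algebra: contraction from the right, and splitting off a basis vector -/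

section Algebra

variable {R : Type*} [CommRing R] {V W : Type*} [AddCommGroup V] [Module R V]
  [AddCommGroup W] [Module R W]

/-- Contraction `x ↦ x⌊δ` of the exterior algebra by a linear form from the right: the linear map
with `1⌊δ = 0` and `(x ∧ v)⌊δ = δ(v) x - (x⌊δ) ∧ v`. -/
def contractR (δ : W →ₗ[R] R) : ExteriorAlgebra R W →ₗ[R] ExteriorAlgebra R W :=
  (CliffordAlgebra.contractRight (Q := (0 : QuadraticForm R W))).flip δ

theorem contractR_mul_ι (δ : W →ₗ[R] R) (x : ExteriorAlgebra R W) (v : W) :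
    contractR δ (x * ExteriorAlgebra.ι R v) = δ v • x - contractR δ x * ExteriorAlgebra.ι R v :=
  CliffordAlgebra.contractRight_mul_ι (Q := (0 : QuadraticForm R W)) δ v x

theorem contractR_algebraMap (δ : W →ₗ[R] R) (r : R) :
    contractR δ (algebraMap R (ExteriorAlgebra R W) r) = 0 :=
  CliffordAlgebra.contractRight_algebraMap (Q := (0 : QuadraticForm R W)) δ r

theorem ext_right_induction {P : ExteriorAlgebra R W → Prop}
    (h1 : ∀ r : R, P (algebraMap R _ r)) (h2 : ∀ x y, P x → P y → P (x + y))
    (h3 : ∀ (v : W) x, P x → P (x * ExteriorAlgebra.ι R v)) (x) : P x :=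
  CliffordAlgebra.right_induction (Q := (0 : QuadraticForm R W)) h1 h2 h3 x

theorem exists_right_eq_left (v : W) (x : ExteriorAlgebra R W) :
    ∃ y, x * ExteriorAlgebra.ι R v = ExteriorAlgebra.ι R v * y := by
  induction x using ext_right_induction with
  | h1 r => exact ⟨algebraMap R _ r, Algebra.commutes r _⟩
  | h2 x y hx hy =>
    obtain ⟨a, ha⟩ := hx
    obtain ⟨b, hb⟩ := hy
    exact ⟨a + b, by rw [add_mul, mul_add, ha, hb]⟩
  | h3 u x hx =>
    obtain ⟨a, ha⟩ := hx
    refine ⟨-(a * ExteriorAlgebra.ι R u), ?_⟩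
    have := eq_neg_of_add_eq_zero_left (ExteriorAlgebra.ι_add_mul_swap (R := R) u v)
    rw [mul_assoc, this, mul_neg, ← mul_assoc, ha, mul_neg, mul_assoc]

theorem exists_left_eq_right (v : W) (x : ExteriorAlgebra R W) :
    ∃ y, ExteriorAlgebra.ι R v * x = y * ExteriorAlgebra.ι R v := by
  induction x using ext_right_induction with
  | h1 r => exact ⟨algebraMap R _ r, (Algebra.commutes r _).symm⟩
  | h2 x y hx hy =>
    obtain ⟨a, ha⟩ := hx
    obtain ⟨b, hb⟩ := hy
    exact ⟨a + b, by rw [add_mul, mul_add, ha, hb]⟩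
  | h3 u x hx =>
    obtain ⟨a, ha⟩ := hx
    refine ⟨-(a * ExteriorAlgebra.ι R u), ?_⟩
    have := eq_neg_of_add_eq_zero_left (ExteriorAlgebra.ι_add_mul_swap (R := R) v u)
    rw [← mul_assoc, ha, mul_assoc, this, mul_neg, ← mul_assoc, neg_mul]

/-- `W = i(V) ⊕ R v₀`, where `pr` and `δ` are the two coordinates. -/
structure SplitOff (i : V →ₗ[R] W) (pr : W →ₗ[R] V) (δ : W →ₗ[R] R) (v₀ : W) : Prop where
  pr_i : ∀ v, pr (i v) = v
  δ_i : ∀ v, δ (i v) = 0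
  pr_v₀ : pr v₀ = 0
  δ_v₀ : δ v₀ = 1
  sum : ∀ w, w = i (pr w) + δ w • v₀

namespace SplitOff

variable {i : V →ₗ[R] W} {pr : W →ₗ[R] V} {δ : W →ₗ[R] R} {v₀ : W}

open ExteriorAlgebra in
theorem contract_map (h : SplitOff i pr δ v₀) (x : ExteriorAlgebra R V) :
    contractR δ (map i x) = 0 := by
  induction x using ext_right_induction with
  | h1 r => simp [contractR_algebraMap]
  | h2 x y hx hy => simp [hx, hy]
  | h3 v x hx => simp [contractR_mul_ι, hx, h.δ_i]

open ExteriorAlgebra in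
theorem contract_map_mul (h : SplitOff i pr δ v₀) (x : ExteriorAlgebra R V) :
    contractR δ (map i x * ι R v₀) = map i x := by
  simp [contractR_mul_ι, h.contract_map, h.δ_v₀]

open ExteriorAlgebra in
theorem map_pr_map (h : SplitOff i pr δ v₀) (x : ExteriorAlgebra R V) :
    map pr (map i x) = x := by
  have : pr ∘ₗ i = LinearMap.id := LinearMap.ext h.pr_i
  have h2 := ExteriorAlgebra.map_comp_map i pr
  rw [this, ExteriorAlgebra.map_id] at h2
  exact DFunLike.congr_fun h2 x

open ExteriorAlgebra in
theorem exists_eq (h : SplitOff i pr δ v₀) (x : ExteriorAlgebra R W) :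
    ∃ a b, x = map i a + map i b * ι R v₀ := by
  induction x using ext_right_induction with
  | h1 r => exact ⟨algebraMap R _ r, 0, by simp⟩
  | h2 x y hx hy =>
    obtain ⟨a, b, rfl⟩ := hx
    obtain ⟨c, d, rfl⟩ := hy
    exact ⟨a + c, b + d, by rw [map_add, map_add, add_mul]; abel⟩
  | h3 w x hx =>
    obtain ⟨a, b, rfl⟩ := hx
    refine ⟨a * ι R (pr w), δ w • a - b * ι R (pr w), ?_⟩
    have h1 : ι R v₀ * ι R (i (pr w)) = -(ι R (i (pr w)) * ι R v₀) :=
      eq_neg_of_add_eq_zero_left (ExteriorAlgebra.ι_add_mul_swap (R := R) _ _)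
    conv_lhs => rw [h.sum w]
    simp only [map_add, map_smul, map_sub, map_mul, map_apply_ι, mul_add, add_mul, sub_mul,
      mul_assoc, h1, mul_smul_comm, smul_mul_assoc, ι_sq_zero, mul_zero, mul_neg]
    rw [add_zero]
    abel

end SplitOff

/-- The subalgebra `Λ^*(ker φ)` of `Λ^* W`. -/
def kerExt (φ : W →ₗ[R] R) : Subalgebra R (ExteriorAlgebra R W) :=
  (ExteriorAlgebra.map (LinearMap.ker φ).subtype).range

/-- The part `Λ^k(ker φ)` of degree `k` of `Λ^*(ker φ)`, as a submodule of `Λ^* W`. -/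
def kerPower (φ : W →ₗ[R] R) (k : ℕ) : Submodule R (ExteriorAlgebra R W) :=
  (⋀[R]^k (LinearMap.ker φ)).map (ExteriorAlgebra.map (LinearMap.ker φ).subtype).toLinearMap

/-- The projection to `ker φ` along a vector `v` with `φ v = 1`. -/
def kerProj (φ : W →ₗ[R] R) (v : W) (hv : φ v = 1) : W →ₗ[R] LinearMap.ker φ :=
  (LinearMap.id - φ.smulRight v).codRestrict _ fun w => by simp [hv]

theorem kerProj_coe (φ : W →ₗ[R] R) (v : W) (hv : φ v = 1) (w : W) :
    (kerProj φ v hv w : W) = w - φ w • v := rfl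

theorem splitOff_ker (φ : W →ₗ[R] R) (v : W) (hv : φ v = 1) :
    SplitOff (LinearMap.ker φ).subtype (kerProj φ v hv) φ v where
  pr_i u := by
    have hu : φ u = 0 := u.2
    ext1
    simp [kerProj_coe, hu]
  δ_i u := u.2
  pr_v₀ := by
    ext1
    simp [kerProj_coe, hv]
  δ_v₀ := hv
  sum w := by simp [kerProj_coe]

open ExteriorAlgebra in
theorem contractR_mul_of_mem_kerExt {φ : W →ₗ[R] R} {v : W} (hv : φ v = 1)
    {x : ExteriorAlgebra R W} (hx : x ∈ kerExt φ) : contractR φ (x * ι R v) = x := by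
  obtain ⟨a, rfl⟩ := hx
  exact (splitOff_ker φ v hv).contract_map_mul a

open ExteriorAlgebra in
theorem exists_kerExt_of_left_mul (φ : W →ₗ[R] R) {v : W} (hv : φ v = 1)
    (x : ExteriorAlgebra R W) : ∃ a ∈ kerExt φ, ι R v * x = a * ι R v := by
  obtain ⟨z, hz⟩ := exists_left_eq_right v x
  obtain ⟨a, b, rfl⟩ := (splitOff_ker φ v hv).exists_eq z
  exact ⟨_, ⟨a, rfl⟩, by
    rw [hz, add_mul, mul_assoc, ι_sq_zero, mul_zero, add_zero]; rfl⟩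

end Algebra
/-! ### Link diagrams, resolutions and circles -/

/-- A combinatorial code of an oriented link diagram with an arrow chosen at each crossing.
`Pt` is a finite set of points of the diagram away from the crossings, at least one on each arc;
`glue p q` says that `p`, `q` are joined by a piece of the diagram free of crossings.
At a crossing `x`, the four neighbouring points are `e x 0, e x 1, e x 2, e x 3` in counterclockwise
order, numbered so that the 0-smoothing joins `e x 0` to `e x 1` and `e x 2` to `e x 3` (and hence
the 1-smoothing joins `e x 1` to `e x 2` and `e x 3` to `e x 0`), and so that the arrow of the
crossing points, in the 0-smoothing, from the arc `{e x 0, e x 1}` to the arc `{e x 2, e x 3}`.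
Rotated clockwise by 90 degrees, the arrow points, in the 1-smoothing, from the arc
`{e x 3, e x 0}` to the arc `{e x 1, e x 2}`. -/
structure LinkDiagram where
  Pt : Type
  Crossing : Type
  finitePt : Finite Pt
  fintypeCrossing : Fintype Crossing
  decEqCrossing : DecidableEq Crossing
  /-- whether the crossing is positive -/
  positive : Crossing → Bool
  glue : Pt → Pt → Prop
  e : Crossing → Fin 4 → Pt

attribute [instance] LinkDiagram.finitePt LinkDiagram.fintypeCrossing LinkDiagram.decEqCrossing

namespace LinkDiagram

variable (D : LinkDiagram)

/-- Resolutions `α : 𝒳 → {0, 1}`; `false` stands for `0` and `true` for `1`. -/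
abbrev Resolution : Type := D.Crossing → Bool

/-- The length `|α| = ∑ α(x)`. -/
def len (α : D.Resolution) : ℕ := (Finset.univ.filter fun x => α x = true).card

/-- The number of positive crossings. -/
def nPos : ℕ := (Finset.univ.filter fun x => D.positive x = true).card

/-- The number of negative crossings. -/
def nNeg : ℕ := (Finset.univ.filter fun x => D.positive x = false).card

/-- The pairs of points joined by a piece of arc in the resolution diagram of `α`. -/
inductive Join (α : D.Resolution) : D.Pt → D.Pt → Prop
  | glue {p q : D.Pt} (h : D.glue p q) : Join α p q
  | zero01 (x : D.Crossing) (h : α x = false) : Join α (D.e x 0) (D.e x 1)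
  | zero23 (x : D.Crossing) (h : α x = false) : Join α (D.e x 2) (D.e x 3)
  | one12 (x : D.Crossing) (h : α x = true) : Join α (D.e x 1) (D.e x 2)
  | one30 (x : D.Crossing) (h : α x = true) : Join α (D.e x 3) (D.e x 0)

/-- The circles of the resolution diagram of `α`: the classes of points for the equivalence
relation generated by `Join α`. -/
abbrev Circle (α : D.Resolution) : Type := Quot (D.Join α)

/-- The circle through the point `p` in the resolution `α`. -/
def circleOf (α : D.Resolution) (p : D.Pt) : D.Circle α := Quot.mk _ p

/-- The two arcs of the 0-smoothing at `x` lie on one circle of `α`. For `α x = 0` this says that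
the edge of the cube from `α` in direction `x` is a split; otherwise it is a merge. -/
def IsSplit (α : D.Resolution) (x : D.Crossing) : Prop :=
  D.circleOf α (D.e x 0) = D.circleOf α (D.e x 2)

/-- A circle of `β` having a point in common with the given circle of `α`. If `α → β` is a merge,
this is the circle into which the given one goes; if `α → β` is a split, the circle that is split
goes to one of its two parts (which one does not matter for `edgeMap` below). -/
def transfer (α β : D.Resolution) (c : D.Circle α) : D.Circle β := D.circleOf β (Quot.out c)

section Modules

variable (R : Type*) [CommRing R]

/-- `V_α`, the free module on the circles of `α`. -/
abbrev V (α : D.Resolution) : Type _ := D.Circle α →₀ R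

/-- The vertex module `Λ^* V_α`. -/
abbrev Ext (α : D.Resolution) : Type _ := ExteriorAlgebra R (D.V R α)

/-- The generator of `V_α` of the circle through the point `p`. -/
def gen (α : D.Resolution) (p : D.Pt) : D.V R α := Finsupp.single (D.circleOf α p) 1

/-- `φ_α : V_α → R`, the sum of the coefficients. -/
def aug (α : D.Resolution) : D.V R α →ₗ[R] R := Finsupp.linearCombination R fun _ => (1 : R)

/-- The algebra map induced by `transfer`. -/
def transferMap (α β : D.Resolution) : D.Ext R α →ₐ[R] D.Ext R β :=
  ExteriorAlgebra.map (Finsupp.lmapDomain R R (D.transfer α β))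

open Classical in
/-- The map (without sign) of the edge from `α` to `β` in direction `x`: the identification of the
two generators for a merge; `ω ↦ (v_{a₀} - v_{a₁}) ∧ ω` for a split, where the arrow of `x` in
the 1-smoothing points from the circle `a₀` to the circle `a₁`. -/
def edgeMap (x : D.Crossing) (α β : D.Resolution) : D.Ext R α →ₗ[R] D.Ext R β :=
  if D.IsSplit α x then
    LinearMap.mulLeft R (ExteriorAlgebra.ι R (D.gen R β (D.e x 0) - D.gen R β (D.e x 2))) ∘ₗ
      (D.transferMap R α β).toLinearMap
  else (D.transferMap R α β).toLinearMap

/-- The underlying module of `C(D)`, the direct sum of the vertex modules. -/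
abbrev Chain : Type _ := ∀ α : D.Resolution, D.Ext R α

/-- The differential of `C(D)`, the sum of the edge maps with the signs `ε α x`. (The pair `α`, `x`
with `α x = 0` stands for the edge that starts at `α` and changes the value at `x`.) -/
def diff (ε : D.Resolution → D.Crossing → ℤˣ) : D.Chain R →ₗ[R] D.Chain R :=
  LinearMap.pi fun β => ∑ x : D.Crossing,
    if β x = true then
      ((ε (Function.update β x false) x : ℤˣ) : ℤ) •
        (D.edgeMap R x (Function.update β x false) β ∘ₗ
          LinearMap.proj (Function.update β x false))
    else 0

end Modules

/-- The face at `α` in directions `x`, `y`, in which one circle is split along either of two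
arrows and any of the two splits turns the other arrow into a merge (types X and Y). -/
def IsLadybug (α : D.Resolution) (x y : D.Crossing) : Prop :=
  D.IsSplit α x ∧ D.IsSplit α y ∧ ¬ D.IsSplit (Function.update α x true) y

/-- Type X: after the split at `x`, the tail of the arrow `y` lies on the circle at the head of
the rotated arrow `x`. -/
def IsTypeX (α : D.Resolution) (x y : D.Crossing) : Prop :=
  D.IsLadybug α x y ∧
    D.circleOf (Function.update α x true) (D.e y 0) =
      D.circleOf (Function.update α x true) (D.e x 2)

/-- Type Y: after the split at `x`, the tail of the arrow `y` lies on the circle at the tail of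
the rotated arrow `x`. -/
def IsTypeY (α : D.Resolution) (x y : D.Crossing) : Prop :=
  D.IsLadybug α x y ∧
    D.circleOf (Function.update α x true) (D.e y 0) =
      D.circleOf (Function.update α x true) (D.e x 0)

/-- The product of the signs of the four edges of a face. -/
def faceSign (ε : D.Resolution → D.Crossing → ℤˣ) (α : D.Resolution) (x y : D.Crossing) : ℤˣ :=
  ε α x * ε (Function.update α x true) y * (ε α y * ε (Function.update α y true) x)

/-- Sign assignments of odd Khovanov homology: with the signs `ε`, the cube is a skew cube (every
face anticommutes), and a face of type X (resp. Y) has an even (resp. odd) number of negative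
edges. (For the remaining faces, which without signs anticommute or commute and are called of
type A and C, the parity is determined by skewness.) -/
structure IsSignAssignment (R : Type*) [CommRing R] (ε : D.Resolution → D.Crossing → ℤˣ) :
    Prop where
  skew : ∀ (α : D.Resolution) (x y : D.Crossing), x ≠ y → α x = false → α y = false →
    ((ε α x * ε (Function.update α x true) y : ℤˣ) : ℤ) •
        (D.edgeMap R y (Function.update α x true)
            (Function.update (Function.update α x true) y true) ∘ₗ
          D.edgeMap R x α (Function.update α x true)) +
      ((ε α y * ε (Function.update α y true) x : ℤˣ) : ℤ) •
        (D.edgeMap R x (Function.update α y true)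
            (Function.update (Function.update α x true) y true) ∘ₗ
          D.edgeMap R y α (Function.update α y true)) = 0
  typeX : ∀ (α : D.Resolution) (x y : D.Crossing), x ≠ y → α x = false → α y = false →
    D.IsTypeX α x y → D.faceSign ε α x y = 1
  typeY : ∀ (α : D.Resolution) (x y : D.Crossing), x ≠ y → α x = false → α y = false →
    D.IsTypeY α x y → D.faceSign ε α x y = -1

/-! ### Bigradings, homology, reduced homology -/

section Homology

variable (R : Type*) [CommRing R]

/-- The homological grading `r = |α| - n₋`. -/
def hDegree (α : D.Resolution) : ℤ := D.len α - D.nNeg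

/-- The quantum grading `Q = d - 2k + n₊ - 2n₋ + |α|` of the `k`-th exterior power at the vertex
`α`, where `d` is the rank of the module of which the exterior power is taken. -/
def qDegree (α : D.Resolution) (d : ℤ) (k : ℕ) : ℤ :=
  d - 2 * k + D.nPos - 2 * D.nNeg + D.len α

/-- The part of bidegree `(r, s)` of `C(D)`. -/
def bigraded (r s : ℤ) : Submodule R (D.Chain R) :=
  Submodule.pi Set.univ fun α =>
    ⨆ k : {k : ℕ // D.hDegree α = r ∧ D.qDegree α (Nat.card (D.Circle α)) k = s},
      ⋀[R]^k.1 (D.V R α)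

/-- The subalgebra `Λ_∘^* V_α = Λ^*(ker φ_α)` of `Λ^* V_α`. -/
def redExt (α : D.Resolution) : Subalgebra R (D.Ext R α) :=
  kerExt (D.aug R α)

/-- The reduced complex `C̄(D)`, inside `C(D)`. -/
def reduced : Submodule R (D.Chain R) :=
  Submodule.pi Set.univ fun α => Subalgebra.toSubmodule (D.redExt R α)

/-- The part of bidegree `(r, s)` of `C̄(D)`; the rank of `ker φ_α` is one less than that
of `V_α`. -/
def redBigraded (r s : ℤ) : Submodule R (D.Chain R) :=
  Submodule.pi Set.univ fun α =>
    ⨆ k : {k : ℕ // D.hDegree α = r ∧ D.qDegree α ((Nat.card (D.Circle α) : ℤ) - 1) k = s},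
      kerPower (D.aug R α) k.1

variable (ε : D.Resolution → D.Crossing → ℤˣ)

/-- Cycles of bidegree `(r, s)`. -/
def cycles (r s : ℤ) : Submodule R (D.Chain R) := LinearMap.ker (D.diff R ε) ⊓ D.bigraded R r s

/-- Boundaries of bidegree `(r, s)`. -/
def boundaries (r s : ℤ) : Submodule R (D.Chain R) := (D.bigraded R (r - 1) s).map (D.diff R ε)

/-- The odd Khovanov homology `Kh'_{r,s}(D)`. -/
abbrev Kh (r s : ℤ) : Type _ :=
  D.cycles R ε r s ⧸ (D.boundaries R ε r s).submoduleOf (D.cycles R ε r s)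

/-- Cycles of bidegree `(r, s)` of the reduced complex. -/
def redCycles (r s : ℤ) : Submodule R (D.Chain R) :=
  LinearMap.ker (D.diff R ε) ⊓ D.redBigraded R r s

/-- Boundaries of bidegree `(r, s)` of the reduced complex. -/
def redBoundaries (r s : ℤ) : Submodule R (D.Chain R) :=
  (D.redBigraded R (r - 1) s).map (D.diff R ε)

/-- The reduced odd Khovanov homology of `D` in bidegree `(r, s)`. -/
abbrev RedKh (r s : ℤ) : Type _ :=
  D.redCycles R ε r s ⧸ (D.redBoundaries R ε r s).submoduleOf (D.redCycles R ε r s)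

/-- The class in `Kh'_{r,s}(D)` of a cycle. -/
def khClass {r s : ℤ} (z : D.Chain R) (hz : z ∈ D.cycles R ε r s) : D.Kh R ε r s :=
  Submodule.Quotient.mk ⟨z, hz⟩

/-- The class in the reduced homology of a cycle of the reduced complex. -/
def redKhClass {r s : ℤ} (z : D.Chain R) (hz : z ∈ D.redCycles R ε r s) : D.RedKh R ε r s :=
  Submodule.Quotient.mk ⟨z, hz⟩

end Homology

/-! ### The isomorphism between the pointed and the reduced complex -/

section Pointed

variable (R : Type*) [CommRing R]

/-- The pointed complex `C̄^{(p)}(D) = v_p ∧ C(D)`, inside `C(D)`. -/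
def pointed (p : D.Pt) : Submodule R (D.Chain R) :=
  Submodule.pi Set.univ fun α =>
    LinearMap.range (LinearMap.mulLeft R (ExteriorAlgebra.ι R (D.gen R α p)))

/-- At every vertex, `ω ↦ ω ∧ v_p`. -/
def wedge (p : D.Pt) : D.Chain R →ₗ[R] D.Chain R :=
  LinearMap.pi fun α =>
    LinearMap.mulRight R (ExteriorAlgebra.ι R (D.gen R α p)) ∘ₗ LinearMap.proj α

/-- At every vertex, the contraction by `φ_α`. -/
def contractAug : D.Chain R →ₗ[R] D.Chain R :=
  LinearMap.pi fun α => contractR (D.aug R α) ∘ₗ LinearMap.proj α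

theorem aug_gen (α : D.Resolution) (p : D.Pt) : D.aug R α (D.gen R α p) = 1 := by
  simp [aug, gen]

theorem wedge_mem_pointed (p : D.Pt) (ω : D.Chain R) : D.wedge R p ω ∈ D.pointed R p := by
  intro α _
  obtain ⟨y, hy⟩ := exists_right_eq_left (D.gen R α p) (ω α)
  exact ⟨y, hy.symm⟩

theorem exists_of_mem_pointed {p : D.Pt} {ω : D.Chain R} (h : ω ∈ D.pointed R p)
    (α : D.Resolution) :
    ∃ a ∈ D.redExt R α, ω α = a * ExteriorAlgebra.ι R (D.gen R α p) := by
  obtain ⟨y, hy⟩ := h α (Set.mem_univ α)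
  obtain ⟨a, ha, h⟩ := exists_kerExt_of_left_mul (D.aug R α) (D.aug_gen R α p) y
  exact ⟨a, ha, by rw [← hy, LinearMap.mulLeft_apply, h]⟩

/-- The isomorphism `X_D^p : C̄^{(p)}(D) → C̄(D)`, `ω ∧ v_p ↦ ω` for `ω` in `C̄(D)`; that is, the
contraction by the forms `φ_α`. Its inverse is `ω ↦ ω ∧ v_p`. -/
def X (p : D.Pt) : D.pointed R p ≃ₗ[R] D.reduced R where
  toLinearMap := (D.contractAug R).restrict fun ω h α _ => by
    obtain ⟨a, ha, e⟩ := D.exists_of_mem_pointed R h α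
    have : D.contractAug R ω α = a := by
      simp [contractAug, e, contractR_mul_of_mem_kerExt (D.aug_gen R α p) ha]
    rw [this]
    exact ha
  invFun ω := ⟨D.wedge R p ω.1, D.wedge_mem_pointed R p ω.1⟩
  left_inv ω := by
    ext1
    funext α
    obtain ⟨a, ha, e⟩ := D.exists_of_mem_pointed R ω.2 α
    simp [wedge, contractAug, e, contractR_mul_of_mem_kerExt (D.aug_gen R α p) ha]
  right_inv ω := by
    ext1
    funext α
    have ha : ω.1 α ∈ kerExt (D.aug R α) := ω.2 α (Set.mem_univ α)
    simp [wedge, contractAug, contractR_mul_of_mem_kerExt (D.aug_gen R α p) ha]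

end Pointed

/-! ### Adding an unknot, and the splitting of `C(D)` -/

/-- The diagram `D ⊔ O` with an additional unknotted circle `O` without crossings, on which lies
the point `none`. -/
abbrev addCircle : LinkDiagram where
  Pt := Option D.Pt
  Crossing := D.Crossing
  finitePt := inferInstance
  fintypeCrossing := D.fintypeCrossing
  decEqCrossing := D.decEqCrossing
  positive := D.positive
  glue p q := ∃ p' q', p = some p' ∧ q = some q' ∧ D.glue p' q'
  e x j := some (D.e x j)

section Splitting

variable (R : Type*) [CommRing R]

/-- The circles of a resolution of `D` as circles of the resolution of `D ⊔ O`. -/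
def inclCircle (α : D.Resolution) : D.Circle α → D.addCircle.Circle α :=
  Quot.map some fun p q h => by
    cases h with
    | glue h => exact .glue ⟨_, _, rfl, rfl, h⟩
    | zero01 x h => exact .zero01 (D := D.addCircle) x h
    | zero23 x h => exact .zero23 (D := D.addCircle) x h
    | one12 x h => exact .one12 (D := D.addCircle) x h
    | one30 x h => exact .one30 (D := D.addCircle) x h

/-- A function of the circles of a resolution of `D ⊔ O`, given by its value at `O` and
its values at the circles of the resolution of `D`. -/
def circleRec {T : Type*} (α : D.Resolution) (t : T) (f : D.Circle α → T) :
    D.addCircle.Circle α → T :=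
  Quot.lift (fun p : Option D.Pt => p.elim t fun p' => f (D.circleOf α p')) fun p q h => by
    cases h with
    | glue h =>
      obtain ⟨p', q', rfl, rfl, h⟩ := h
      exact congrArg f (Quot.sound (.glue h))
    | zero01 x h => exact congrArg f (Quot.sound (Join.zero01 (D := D) x h))
    | zero23 x h => exact congrArg f (Quot.sound (Join.zero23 (D := D) x h))
    | one12 x h => exact congrArg f (Quot.sound (Join.one12 (D := D) x h))
    | one30 x h => exact congrArg f (Quot.sound (Join.one30 (D := D) x h))

/-- The inclusion `V_α → V'_α = V_α ⊕ ⟨v₀⟩`. -/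
def inclV (α : D.Resolution) : D.V R α →ₗ[R] D.addCircle.V R α :=
  Finsupp.lmapDomain R R (D.inclCircle α)

/-- The projection `V'_α → V_α` with `v₀ ↦ 0`. -/
def projV (α : D.Resolution) : D.addCircle.V R α →ₗ[R] D.V R α :=
  Finsupp.linearCombination R (D.circleRec α 0 fun c => Finsupp.single c 1)

/-- The coordinate of `v₀` on `V'_α`. -/
def coordO (α : D.Resolution) : D.addCircle.V R α →ₗ[R] R :=
  Finsupp.linearCombination R (D.circleRec α 1 fun _ => (0 : R))

theorem splitOff_circle (α : D.Resolution) :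
    SplitOff (D.inclV R α) (D.projV R α) (D.coordO R α) (D.addCircle.gen R α none) where
  pr_i v := by
    have : D.projV R α ∘ₗ D.inclV R α = LinearMap.id := by
      ext1 c
      induction c using Quot.ind
      ext1
      simp [projV, inclV, inclCircle, circleRec, Quot.map, circleOf]
    exact LinearMap.congr_fun this v
  δ_i v := by
    have : D.coordO R α ∘ₗ D.inclV R α = 0 := by
      ext1 c
      induction c using Quot.ind
      ext1
      simp [coordO, inclV, inclCircle, circleRec, Quot.map]
    exact LinearMap.congr_fun this v
  pr_v₀ := by simp [projV, gen, circleRec, circleOf]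
  δ_v₀ := by simp [coordO, gen, circleRec, circleOf]
  sum w := by
    have : (LinearMap.id : D.addCircle.V R α →ₗ[R] D.addCircle.V R α) =
        D.inclV R α ∘ₗ D.projV R α +
          (D.coordO R α).smulRight (D.addCircle.gen R α none) := by
      ext1 c
      induction c using Quot.ind with
      | mk p =>
        apply LinearMap.ext_ring
        cases p with
        | none => simp [projV, inclV, coordO, gen, circleRec, circleOf]
        | some p =>
          simp [projV, inclV, coordO, inclCircle, circleRec, circleOf, Quot.map]
    exact LinearMap.congr_fun this w

/-- The inclusion `C(D) → C(D ⊔ O)`. -/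
def inclChain : D.Chain R →ₗ[R] D.addCircle.Chain R :=
  LinearMap.pi fun α => (ExteriorAlgebra.map (D.inclV R α)).toLinearMap ∘ₗ LinearMap.proj α

/-- The projection `C(D ⊔ O) → C(D)` with `ω ↦ ω`, `ω ∧ v₀ ↦ 0` for `ω` in `C(D)`. -/
def projChain : D.addCircle.Chain R →ₗ[R] D.Chain R :=
  LinearMap.pi fun α => (ExteriorAlgebra.map (D.projV R α)).toLinearMap ∘ₗ
    LinearMap.proj (φ := fun α : D.Resolution => D.addCircle.Ext R α) α

/-- The projection `C(D ⊔ O) → C(D)` with `ω ↦ 0`, `ω ∧ v₀ ↦ ω` for `ω` in `C(D)`. -/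
def coordChain : D.addCircle.Chain R →ₗ[R] D.Chain R :=
  LinearMap.pi fun α => (ExteriorAlgebra.map (D.projV R α)).toLinearMap ∘ₗ
    contractR (D.coordO R α) ∘ₗ
      LinearMap.proj (φ := fun α : D.Resolution => D.addCircle.Ext R α) α

theorem projChain_incl (ω : D.Chain R) : D.projChain R (D.inclChain R ω) = ω := by
  funext α
  exact (D.splitOff_circle R α).map_pr_map (ω α)

theorem coordChain_incl (ω : D.Chain R) : D.coordChain R (D.inclChain R ω) = 0 := by
  funext α
  exact (congrArg _ ((D.splitOff_circle R α).contract_map (ω α))).trans (map_zero _)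

theorem projChain_wedge (ω : D.Chain R) :
    D.projChain R (D.addCircle.wedge R none (D.inclChain R ω)) = 0 := by
  funext α
  refine (map_mul (ExteriorAlgebra.map (D.projV R α)) _ _).trans ?_
  rw [ExteriorAlgebra.map_apply_ι, (D.splitOff_circle R α).pr_v₀, map_zero, mul_zero]
  rfl

theorem coordChain_wedge (ω : D.Chain R) :
    D.coordChain R (D.addCircle.wedge R none (D.inclChain R ω)) = ω := by
  funext α
  exact (congrArg _ ((D.splitOff_circle R α).contract_map_mul (ω α))).trans
    ((D.splitOff_circle R α).map_pr_map (ω α))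

theorem exists_incl_add_wedge (z : D.addCircle.Chain R) :
    ∃ a b, z = D.inclChain R a + D.addCircle.wedge R none (D.inclChain R b) := by
  choose a b h using fun α : D.Resolution => (D.splitOff_circle R α).exists_eq (z α)
  exact ⟨a, b, funext h⟩

theorem wedge_wedge (p : D.Pt) (ω : D.Chain R) : D.wedge R p (D.wedge R p ω) = 0 := by
  funext α
  simp [wedge, mul_assoc]

theorem exists_wedge_of_mem_pointed {p : D.Pt} {z : D.Chain R} (h : z ∈ D.pointed R p) :
    ∃ y, z = D.wedge R p y := by
  choose a _ e using D.exists_of_mem_pointed R h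
  exact ⟨a, funext e⟩

/-- `Φ₁ : C(D) → C̄^{(p)}(D ⊔ O)` with `p` on `O`, given by `ω ↦ ω ∧ v₀`. -/
def Phi1 : D.Chain R ≃ₗ[R] D.addCircle.pointed R none where
  toLinearMap := (D.addCircle.wedge R none ∘ₗ D.inclChain R).codRestrict _ fun _ =>
    D.addCircle.wedge_mem_pointed R none _
  invFun z := D.coordChain R z.1
  left_inv ω := D.coordChain_wedge R ω
  right_inv z := by
    ext1
    obtain ⟨y, hy⟩ := D.addCircle.exists_wedge_of_mem_pointed R z.2
    obtain ⟨a, b, rfl⟩ := D.exists_incl_add_wedge R y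
    rw [map_add, wedge_wedge, add_zero] at hy
    change D.addCircle.wedge R none (D.inclChain R (D.coordChain R z.1)) = z.1
    rw [hy, coordChain_wedge]

/-- `Φ₂ = (X^q)⁻¹ ∘ X^p`, for `D ⊔ O`, with `p` on `O` and `q` on `D`. -/
def Phi2 (q : D.Pt) : D.addCircle.pointed R none ≃ₗ[R] D.addCircle.pointed R (some q) :=
  (D.addCircle.X R none).trans (D.addCircle.X R (some q)).symm

theorem inclV_gen (α : D.Resolution) (q : D.Pt) :
    D.inclV R α (D.gen R α q) = D.addCircle.gen R α (some q) := by
  simp [inclV, gen, inclCircle, circleOf, Quot.map]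

theorem inclChain_mem_pointed {q : D.Pt} {η : D.Chain R} (h : η ∈ D.pointed R q) :
    D.inclChain R η ∈ D.addCircle.pointed R (some q) := by
  intro α _
  obtain ⟨y, hy⟩ := h α (Set.mem_univ α)
  refine ⟨ExteriorAlgebra.map (D.inclV R α) y, ?_⟩
  refine Eq.trans ?_ (congrArg (ExteriorAlgebra.map (D.inclV R α)) hy)
  rw [LinearMap.mulLeft_apply, LinearMap.mulLeft_apply, map_mul, ExteriorAlgebra.map_apply_ι,
    inclV_gen]

theorem wedge_mem_pointed_of_mem {p q : D.Pt} {η : D.Chain R} (h : η ∈ D.pointed R q) :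
    D.wedge R p η ∈ D.pointed R q := by
  intro α _
  obtain ⟨y, hy⟩ := h α (Set.mem_univ α)
  refine ⟨y * ExteriorAlgebra.ι R (D.gen R α p), ?_⟩
  rw [LinearMap.mulLeft_apply, ← mul_assoc]
  exact congrArg (· * ExteriorAlgebra.ι R (D.gen R α p)) hy

/-- Elements of `v_q ∧ C(D ⊔ O)` are sums `a + b ∧ v₀` with `a`, `b` in `v_q ∧ C(D)`. -/
theorem exists_pointed_add_wedge {q : D.Pt} {z : D.addCircle.Chain R}
    (h : z ∈ D.addCircle.pointed R (some q)) : ∃ a ∈ D.pointed R q, ∃ b ∈ D.pointed R q,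
      z = D.inclChain R a + D.addCircle.wedge R none (D.inclChain R b) := by
  choose y hy using fun α : D.Resolution => h α (Set.mem_univ α)
  obtain ⟨a, b, hab⟩ := D.exists_incl_add_wedge R y
  refine ⟨fun α => ExteriorAlgebra.ι R (D.gen R α q) * a α, fun α _ => ⟨a α, rfl⟩,
    fun α => ExteriorAlgebra.ι R (D.gen R α q) * b α, fun α _ => ⟨b α, rfl⟩, funext fun α => ?_⟩
  rw [← hy α, hab]
  change _ * (ExteriorAlgebra.map (D.inclV R α) (a α) +
      ExteriorAlgebra.map (D.inclV R α) (b α) * _) =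
    ExteriorAlgebra.map (D.inclV R α) (_ * a α) + ExteriorAlgebra.map (D.inclV R α) (_ * b α) * _
  rw [map_mul, map_mul, ExteriorAlgebra.map_apply_ι, inclV_gen, mul_add, mul_assoc]

/-- `Φ₃ : C̄^{(q)}(D ⊔ O) → C̄^{(q)}(D) ⊕ C̄^{(q)}(D)` with `q` on `D`, given by `ω ↦ (ω, 0)` and
`ω ∧ v₀ ↦ (0, ω)` for `ω` in `C̄^{(q)}(D)`. -/
def Phi3 (q : D.Pt) :
    D.addCircle.pointed R (some q) ≃ₗ[R] D.pointed R q × D.pointed R q where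
  toLinearMap :=
    ((D.projChain R).restrict (p := D.addCircle.pointed R (some q)) (q := D.pointed R q)
      fun z hz => by
        obtain ⟨a, ha, b, _, rfl⟩ := D.exists_pointed_add_wedge R hz
        rwa [map_add, projChain_incl, projChain_wedge, add_zero]).prod
    ((D.coordChain R).restrict (p := D.addCircle.pointed R (some q)) (q := D.pointed R q)
      fun z hz => by
        obtain ⟨a, _, b, hb, rfl⟩ := D.exists_pointed_add_wedge R hz
        rwa [map_add, coordChain_incl, coordChain_wedge, zero_add])
  invFun η := ⟨D.inclChain R η.1.1 + D.addCircle.wedge R none (D.inclChain R η.2.1),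
    add_mem (D.inclChain_mem_pointed R η.1.2)
      (D.addCircle.wedge_mem_pointed_of_mem R (D.inclChain_mem_pointed R η.2.2))⟩
  left_inv z := by
    ext1
    obtain ⟨a, b, hab⟩ := D.exists_incl_add_wedge R z.1
    change D.inclChain R (D.projChain R z.1) +
      D.addCircle.wedge R none (D.inclChain R (D.coordChain R z.1)) = z.1
    have h1 : D.projChain R z.1 = a := by
      rw [hab, map_add, projChain_incl, projChain_wedge, add_zero]
    have h2 : D.coordChain R z.1 = b := by
      rw [hab, map_add, coordChain_incl, coordChain_wedge, zero_add]
    rw [h1, h2, ← hab]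
  right_inv η := by
    refine Prod.ext (Subtype.ext ?_) (Subtype.ext ?_)
    · change D.projChain R (D.inclChain R η.1.1 +
        D.addCircle.wedge R none (D.inclChain R η.2.1)) = η.1.1
      rw [map_add, projChain_incl, projChain_wedge, add_zero]
    · change D.coordChain R (D.inclChain R η.1.1 +
        D.addCircle.wedge R none (D.inclChain R η.2.1)) = η.2.1
      rw [map_add, coordChain_incl, coordChain_wedge, zero_add]

/-- `Φ₄ = X^q ⊕ X^q`. -/
def Phi4 (q : D.Pt) : (D.pointed R q × D.pointed R q) ≃ₗ[R] D.reduced R × D.reduced R :=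
  (D.X R q).prodCongr (D.X R q)

/-- The splitting `Φ = Φ₄ ∘ Φ₃ ∘ Φ₂ ∘ Φ₁ : C(D) → C̄(D) ⊕ C̄(D)`. -/
def Phi (q : D.Pt) : D.Chain R ≃ₗ[R] D.reduced R × D.reduced R :=
  (((D.Phi1 R).trans (D.Phi2 R q)).trans (D.Phi3 R q)).trans (D.Phi4 R q)

end Splitting

end LinkDiagram

/-! ### Closed braids and the invariants -/

/-- Braid words on `m + 1` strands: the letter `(i, true)` is the positive crossing and the letter
`(i, false)` the negative crossing between the strands in positions `i` and `i + 1`. -/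
abbrev BraidWord (m : ℕ) : Type := List (Fin m × Bool)

namespace BraidWord

variable {m : ℕ} (w : BraidWord m)

/-- The points around the `k`-th crossing of the braid, counterclockwise: top left, bottom left,
bottom right, top right. The braid runs upwards; `(k, j)` is the point in position `j` between
the crossings number `k - 1` and `k`. -/
def corner (k : Fin w.length) : Fin 4 → Fin (w.length + 1) × Fin (m + 1) :=
  ![(k.succ, (w.get k).1.castSucc), (k.castSucc, (w.get k).1.castSucc),
    (k.castSucc, (w.get k).1.succ), (k.succ, (w.get k).1.succ)]

/-- The diagram of the closed braid. The 0-smoothing of a positive crossing and the 1-smoothing of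
a negative crossing consist of two vertical arcs. The arrow at the crossing `k` in the
0-smoothing points from left to right (positive crossing) or from bottom to top (negative
crossing) if `o k = false`, and in the opposite direction if `o k = true`. -/
def closure (o : Fin w.length → Bool) : LinkDiagram where
  Pt := Fin (w.length + 1) × Fin (m + 1)
  Crossing := Fin w.length
  finitePt := inferInstance
  fintypeCrossing := inferInstance
  decEqCrossing := inferInstance
  positive k := (w.get k).2
  glue p q :=
    (∃ j, p = (0, j) ∧ q = (Fin.last _, j)) ∨
      ∃ (k : Fin w.length) (j : Fin (m + 1)), j ≠ (w.get k).1.castSucc ∧ j ≠ (w.get k).1.succ ∧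
        p = (k.castSucc, j) ∧ q = (k.succ, j)
  e k j := w.corner k (j + (if (w.get k).2 then 0 else 1) + (if o k then 2 else 0))

/-- The self-linking number `-b + n₊ - n₋`, with `b = m + 1`. -/
def sl : ℤ := -((m : ℤ) + 1) + (w.countP fun l => l.2) - (w.countP fun l => !l.2)

variable (o : Fin w.length → Bool)

/-- The resolution `α'` into `b` parallel strands: the 0-smoothing at each positive and the
1-smoothing at each negative crossing. -/
def braidResolution : (w.closure o).Resolution := fun k => !(w.closure o).positive k

/-- The generator of `V_{α'}` of the strand in position `j`. -/
def strand (R : Type*) [CommRing R] (j : Fin (m + 1)) : (w.closure o).V R (w.braidResolution o) :=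
  (w.closure o).gen R (w.braidResolution o) ((0, j) : Fin (w.length + 1) × Fin (m + 1))

/-- `ψ(D) = v_1 ∧ ⋯ ∧ v_b` in `Λ^b V_{α'}`. -/
def psi (R : Type*) [CommRing R] : (w.closure o).Chain R :=
  Pi.single (w.braidResolution o) (ExteriorAlgebra.ιMulti R (m + 1) (w.strand o R))

/-- The reduced invariant `(v_1 - v_2) ∧ ⋯ ∧ (v_{b-1} - v_b)`, a generator of
`Λ_∘^{b-1} V_{α'}`. -/
def redPsi (R : Type*) [CommRing R] : (w.closure o).Chain R :=
  Pi.single (w.braidResolution o)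
    (ExteriorAlgebra.ιMulti R m fun j => w.strand o R j.castSucc - w.strand o R j.succ)

end BraidWord

end OddKhovanov

/-! Everything reduces to two operators on chains: contraction from the right by the forms `φ_α`,
written `ω ↦ ω⌊φ`, and the wedge `ω ↦ ω ∧ v_q`. They satisfy `(ω ∧ v_q)⌊φ = ω - (ω⌊φ) ∧ v_q`
(`contractAug_wedge`), both square to zero, and the reduced complex is the kernel of the contraction
(`mem_reduced_iff`). Carrying `ω` through the four factors of `Φ` gives `Φ ω = ((ω ∧ v_q)⌊φ, ω⌊φ)`
(`coe_Phi_fst`, `coe_Phi_snd`), hence `Φ⁻¹(0, z) = z ∧ v_q` (`Phi_symm_zero_left`).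

Both operators commute with the differential. For the contraction, edge maps preserve the sum of
coefficients and a split multiplies by a vector of `ker φ` (`contractR_edgeMap`). For the wedge, an
edge sends `v_q` to `v_q` up to a multiple of `v_{a₀} - v_{a₁}`; this error is killed by the factor
of a split and vanishes for a merge (`IsClosed.edgeMap_mul_gen`). The merge case needs the two
circles really to become one. That can fail for an arbitrary combinatorial code, so it is derived
from the parity condition `IsClosed` (`IsClosed.circleOf_eq_of_not_isSplit`), which closed braids
satisfy (`isClosed_closure`).

On homology `z ↦ z ∧ v_q` is injective because contraction is a left inverse on reduced chains. The
reduced invariant is a cycle because each edge leaving the oriented resolution merges two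
neighbouring strands and so kills one factor `v_i - v_{i+1}` (`diff_redPsi`). Wedging it with any
`v_j` gives `v_1 ∧ ⋯ ∧ v_b`, with sign `+` (`ιMulti_sub_mul_ι`). -/

namespace OddKhovanov

/-! ### Exterior algebra: right contraction, the kernel of a form, telescoping wedges -/

section ExteriorLemmas

open ExteriorAlgebra

variable {R : Type*} [CommRing R] {V W : Type*} [AddCommGroup V] [Module R V]
  [AddCommGroup W] [Module R W]

theorem contractR_map (f : V →ₗ[R] W) (δ : W →ₗ[R] R) (x : ExteriorAlgebra R V) :
    contractR δ (map f x) = map f (contractR (δ ∘ₗ f) x) := by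
  induction x using ext_right_induction with
  | h1 r => simp [contractR_algebraMap]
  | h2 x y hx hy => simp [hx, hy]
  | h3 v x hx => simp [contractR_mul_ι, hx]

/-- Contraction acts from the right, so a left factor on which the form vanishes is passed without a
sign. This is why contraction commutes, rather than anticommutes, with splits. -/
theorem contractR_ι_mul {δ : W →ₗ[R] R} {u : W} (hu : δ u = 0) (x : ExteriorAlgebra R W) :
    contractR δ (ι R u * x) = ι R u * contractR δ x := by
  induction x using ext_right_induction with
  | h1 r =>
    rw [← Algebra.commutes, contractR_mul_ι, contractR_algebraMap, hu]
    simp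
  | h2 x y hx hy => simp [mul_add, hx, hy]
  | h3 v x hx => rw [← mul_assoc, contractR_mul_ι, contractR_mul_ι, hx]; simp [mul_sub, mul_assoc]

theorem contractR_contractR (δ : W →ₗ[R] R) (x : ExteriorAlgebra R W) :
    contractR δ (contractR δ x) = 0 := by
  induction x using ext_right_induction with
  | h1 r => simp [contractR_algebraMap]
  | h2 x y hx hy => simp [hx, hy]
  | h3 v x hx => simp [contractR_mul_ι, hx]

theorem ι_mul_mul_ι (u : W) (x : ExteriorAlgebra R W) : ι R u * x * ι R u = 0 := by
  obtain ⟨y, hy⟩ := exists_left_eq_right u x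
  rw [hy, mul_assoc, ι_sq_zero, mul_zero]

/-- Writing `x = a + b ∧ v` with `a`, `b` in `Λ^*(ker φ)`, the contraction of `x` is exactly `b`. -/
theorem mem_kerExt_iff {φ : W →ₗ[R] R} {v : W} (hv : φ v = 1) {x : ExteriorAlgebra R W} :
    x ∈ kerExt φ ↔ contractR φ x = 0 := by
  constructor
  · rintro ⟨a, rfl⟩
    exact (splitOff_ker φ v hv).contract_map a
  · intro hx
    obtain ⟨a, b, rfl⟩ := (splitOff_ker φ v hv).exists_eq x
    rw [map_add, (splitOff_ker φ v hv).contract_map, (splitOff_ker φ v hv).contract_map_mul,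
      zero_add] at hx
    rw [hx, zero_mul, add_zero]
    exact ⟨a, rfl⟩

theorem kerPower_le_kerExt (φ : W →ₗ[R] R) (k : ℕ) :
    kerPower φ k ≤ Subalgebra.toSubmodule (kerExt φ) := by
  rintro _ ⟨a, -, rfl⟩
  exact ⟨a, rfl⟩

theorem kerPower_le_exteriorPower (φ : W →ₗ[R] R) (k : ℕ) : kerPower φ k ≤ ⋀[R]^k W := by
  rw [kerPower, Submodule.map_pow]
  refine pow_le_pow_left' ?_ k
  rintro _ ⟨_, ⟨u, rfl⟩, rfl⟩
  exact ⟨u, by simp⟩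

theorem ιMulti_mem_kerPower {φ : W →ₗ[R] R} {n : ℕ}
    {u : Fin n → W} (hu : ∀ j, φ (u j) = 0) : ιMulti R n u ∈ kerPower φ n :=
  ⟨ιMulti R n fun j => ⟨u j, hu j⟩, ιMulti_range R _ ⟨_, rfl⟩,
    map_apply_ιMulti _ _⟩

theorem mul_ι_mem_kerPower {φ : W →ₗ[R] R} {k : ℕ} {x : ExteriorAlgebra R W}
    (hx : x ∈ kerPower φ k) {u : W} (hu : φ u = 0) : x * ι R u ∈ kerPower φ (k + 1) := by
  obtain ⟨a, ha, rfl⟩ := hx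
  refine ⟨a * ι R ⟨u, hu⟩, ?_, by simp⟩
  rw [exteriorPower, pow_succ]
  exact Submodule.mul_mem_mul ha ⟨_, rfl⟩

theorem mul_ι_mem_exteriorPower {φ : W →ₗ[R] R} {k : ℕ} {x : ExteriorAlgebra R W}
    (hx : x ∈ kerPower φ k) (u : W) : x * ι R u ∈ ⋀[R]^(k + 1) W := by
  rw [exteriorPower, pow_succ]
  exact Submodule.mul_mem_mul (kerPower_le_exteriorPower φ k hx) ⟨_, rfl⟩

/-- `Λ^{k-1}(ker φ)`, where `Λ^{-1} = 0`. -/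
def kerPowerPred (φ : W →ₗ[R] R) : ℕ → Submodule R (ExteriorAlgebra R W)
  | 0 => ⊥
  | k + 1 => kerPower φ k

theorem mul_ι_mem_kerPower_of_pred {φ : W →ₗ[R] R} {k : ℕ} {x : ExteriorAlgebra R W}
    (hx : x ∈ kerPowerPred φ k) {u : W} (hu : φ u = 0) : x * ι R u ∈ kerPower φ k := by
  cases k with
  | zero =>
    rw [(Submodule.mem_bot R).1 hx, zero_mul]
    exact zero_mem _
  | succ k => exact mul_ι_mem_kerPower hx hu

/-- These are the two coordinates of `x` in `Λ^k W = Λ^k(ker φ) ⊕ Λ^{k-1}(ker φ) ∧ v`. Only the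
second is needed later, but the induction on right factors mixes them, so both are carried along. -/
theorem contractR_mem_kerPowerPred {φ : W →ₗ[R] R} {v : W} (hv : φ v = 1) {k : ℕ}
    {x : ExteriorAlgebra R W} (hx : x ∈ ⋀[R]^k W) :
    x - contractR φ x * ι R v ∈ kerPower φ k ∧ contractR φ x ∈ kerPowerPred φ k := by
  induction hx using Submodule.pow_induction_on_right' with
  | algebraMap r =>
    rw [contractR_algebraMap, zero_mul, sub_zero]
    refine ⟨⟨algebraMap R _ r, ?_, by simp⟩, zero_mem _⟩
    rw [exteriorPower, pow_zero]
    exact Submodule.algebraMap_mem r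
  | add x y i hx hy h1 h2 =>
    rw [map_add, add_mul, add_sub_add_comm]
    exact ⟨add_mem h1.1 h2.1, add_mem h1.2 h2.2⟩
  | mul_mem i x hx h m hm =>
    obtain ⟨u, rfl⟩ := hm
    obtain ⟨h1, h2⟩ := h
    set c := contractR φ x with hc
    -- The new factor is split as `u = (u - φ(u) v) + φ(u) v`. The first coordinate of `x ∧ u` is
    -- then that of `x` wedged with `u - φ(u) v`.
    have hu : φ (u - φ u • v) = 0 := by simp [hv]
    have h3 := mul_ι_mem_kerPower_of_pred h2 hu
    have h4 := mul_ι_mem_kerPower h1 hu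
    have e1 : contractR φ (x * ι R u) =
        φ u • (x - c * ι R v) - c * ι R (u - φ u • v) := by
      rw [contractR_mul_ι, ← hc]
      simp only [map_sub, map_smul, mul_sub, smul_sub, mul_smul_comm]
      abel
    refine ⟨?_, ?_⟩
    · convert h4 using 1
      have h5 : ι R v * ι R u = -(ι R u * ι R v) :=
        eq_neg_of_add_eq_zero_left (ι_add_mul_swap (R := R) _ _)
      rw [e1]
      simp only [map_sub, map_smul, mul_sub, sub_mul, smul_sub, mul_smul_comm, smul_mul_assoc,
        mul_assoc, h5, ι_sq_zero, mul_zero, smul_zero, mul_neg]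
      abel
    · rw [e1]
      exact sub_mem (Submodule.smul_mem _ _ h1) h3

theorem ιMulti_mul_ι_self {n : ℕ} (u : Fin n → W) (j : Fin n) :
    ιMulti R n u * ι R (u j) = 0 := by
  induction n with
  | zero => exact j.elim0
  | succ n ih =>
    rw [ιMulti_succ_apply]
    cases j using Fin.cases with
    | zero => exact ι_mul_mul_ι _ _
    | succ j =>
      rw [mul_assoc]
      exact (congrArg _ (ih (Matrix.vecTail u) j)).trans (mul_zero _)

/-- By induction, all factors but the first combine with `v_n` to `v_1 ∧ ⋯ ∧ v_n`; in the remaining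
`v_0 - v_1` the term `v_1` contributes nothing, being repeated. -/
theorem ιMulti_sub_mul_ι_last {n : ℕ} (v : Fin (n + 1) → W) :
    ιMulti R n (fun j => v j.castSucc - v j.succ) * ι R (v (Fin.last n)) =
      ιMulti R (n + 1) v := by
  induction n with
  | zero => simp [ιMulti_apply]
  | succ n ih =>
    have h1 := ih (Matrix.vecTail v)
    have h2 : ι R (v 1) * ιMulti R (n + 1) (Matrix.vecTail v) = 0 := by
      have h3 := (ιMulti R (n + 2)).map_eq_zero_of_eq (Matrix.vecCons (v 1) (Matrix.vecTail v))
        (i := 0) (j := 1) (by simp [Matrix.vecTail]) (by simp)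
      rw [ιMulti_succ_apply] at h3
      simpa using h3
    rw [ιMulti_succ_apply, ιMulti_succ_apply (v := v), mul_assoc]
    refine (congrArg _ h1).trans ?_
    simp only [Fin.castSucc_zero, Fin.succ_zero_eq_one, map_sub, sub_mul, h2, sub_zero]

/-- Since `v_i - v_{i+1}` is one of the factors, wedging with `v_i` and with `v_{i+1}` gives the
same result, so every index reduces to the last one. -/
theorem ιMulti_sub_mul_ι {n : ℕ} (v : Fin (n + 1) → W) (j : Fin (n + 1)) :
    ιMulti R n (fun j => v j.castSucc - v j.succ) * ι R (v j) = ιMulti R (n + 1) v := by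
  induction j using Fin.reverseInduction with
  | last => exact ιMulti_sub_mul_ι_last v
  | cast i ih =>
    have h := ιMulti_mul_ι_self (R := R) (fun j => v j.castSucc - v j.succ) i
    rw [map_sub, mul_sub, sub_eq_zero] at h
    exact h.trans ih

end ExteriorLemmas

namespace LinkDiagram

variable (D : LinkDiagram)

/-! ### Edges of the cube -/

/-- Mod 2, the four ends at a crossing of the arcs of the diagram cut at the boundary of a region
cancel if they do so at all other crossings. This holds if every arc has two ends, as in a diagram
of closed curves. -/
def IsClosed : Prop :=
  ∀ (f : D.Pt → ZMod 2) (x : D.Crossing), (∀ p q, D.glue p q → f p = f q) →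
    (∀ y, y ≠ x → ∑ j, f (D.e y j) = 0) → ∑ j, f (D.e x j) = 0

/-- A function on the points that is constant on the arcs away from `x` of a resolution has
sum zero over the four points around every other crossing. -/
theorem sum_corners_eq_zero {α : D.Resolution} {f : D.Pt → ZMod 2} {y : D.Crossing}
    (h : ∀ p q, ((α y = false ∧ (p = D.e y 0 ∧ q = D.e y 1 ∨ p = D.e y 2 ∧ q = D.e y 3)) ∨
      (α y = true ∧ (p = D.e y 1 ∧ q = D.e y 2 ∨ p = D.e y 3 ∧ q = D.e y 0))) → f p = f q) :
    ∑ j, f (D.e y j) = 0 := by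
  rw [Fin.sum_univ_four]
  cases hy : α y
  · rw [h (D.e y 0) (D.e y 1) (by simp [hy]), h (D.e y 2) (D.e y 3) (by simp [hy]),
      CharTwo.add_self_eq_zero, zero_add, CharTwo.add_self_eq_zero]
  · rw [h (D.e y 1) (D.e y 2) (by simp [hy]), h (D.e y 3) (D.e y 0) (by simp [hy]), add_assoc (f _),
      CharTwo.add_self_eq_zero, add_zero, CharTwo.add_self_eq_zero]

variable {D} in
-- A parity argument: if `e x 0` and `e x 2` lay on different circles both before and after the
-- change, the intersection of the old and the new circle through `e x 0` would contain exactly one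
-- of the four points at `x`, although its ends cancel at every other crossing.
theorem IsClosed.circleOf_eq_of_not_isSplit (hD : D.IsClosed) {α : D.Resolution} {x : D.Crossing}
    (hx : α x = false) (h : ¬ D.IsSplit α x) :
    D.circleOf (Function.update α x true) (D.e x 0) =
      D.circleOf (Function.update α x true) (D.e x 2) := by
  classical
  by_contra hne
  set β := Function.update α x true with hβ
  have hβx : β x = true := by simp [hβ]
  let f : D.Pt → ZMod 2 := fun p =>
    if D.circleOf β p = D.circleOf β (D.e x 0) ∧ D.circleOf α p = D.circleOf α (D.e x 0)
    then 1 else 0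
  have hf : ∀ p q, D.Join α p q → D.Join β p q → f p = f q := fun p q h1 h2 => by
    have h3 : D.circleOf α p = D.circleOf α q := Quot.sound h1
    have h4 : D.circleOf β p = D.circleOf β q := Quot.sound h2
    simp only [f, h3, h4]
  have hsum := hD f x (fun p q h => hf p q (.glue h) (.glue h)) fun y hy => by
    have hβy : β y = α y := by simp [hβ, hy]
    refine D.sum_corners_eq_zero (α := α) ?_
    rintro p q (⟨hα, ⟨rfl, rfl⟩ | ⟨rfl, rfl⟩⟩ | ⟨hα, ⟨rfl, rfl⟩ | ⟨rfl, rfl⟩⟩)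
    · exact hf _ _ (.zero01 y hα) (.zero01 y (hβy.trans hα))
    · exact hf _ _ (.zero23 y hα) (.zero23 y (hβy.trans hα))
    · exact hf _ _ (.one12 y hα) (.one12 y (hβy.trans hα))
    · exact hf _ _ (.one30 y hα) (.one30 y (hβy.trans hα))
  have h23 : D.circleOf α (D.e x 2) = D.circleOf α (D.e x 3) := Quot.sound (.zero23 x hx)
  have h12 : D.circleOf β (D.e x 1) = D.circleOf β (D.e x 2) := Quot.sound (.one12 x hβx)
  have hs : ¬ D.circleOf α (D.e x 2) = D.circleOf α (D.e x 0) := fun h' => h h'.symm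
  have f0 : f (D.e x 0) = 1 := by simp [f]
  have f1 : f (D.e x 1) = 0 := if_neg fun h' => hne (h'.1.symm.trans h12)
  have f2 : f (D.e x 2) = 0 := if_neg fun h' => hs h'.2
  have f3 : f (D.e x 3) = 0 := if_neg fun h' => hs (h23.trans h'.2)
  rw [Fin.sum_univ_four, f0, f1, f2, f3] at hsum
  exact absurd hsum (by decide)

section

variable (R : Type*) [CommRing R]

open ExteriorAlgebra

theorem gen_eq_of_join {α : D.Resolution} {p q : D.Pt} (h : D.Join α p q) :
    D.gen R α p = D.gen R α q :=
  congrArg (fun c => Finsupp.single c 1) (Quot.sound h)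

/-- Two points on one circle of `α` lie, after changing the resolution at `x`, on the same circle
or on the two circles at the crossing `x`. -/
theorem gen_sub_gen_mem_span {α : D.Resolution} {x : D.Crossing} {p q : D.Pt}
    (h : D.circleOf α p = D.circleOf α q) :
    D.gen R (Function.update α x true) p - D.gen R (Function.update α x true) q ∈
      Submodule.span R {D.gen R (Function.update α x true) (D.e x 0) -
        D.gen R (Function.update α x true) (D.e x 2)} := by
  set β := Function.update α x true with hβ
  have hβx : β x = true := by simp [hβ]
  have h12 : D.gen R β (D.e x 1) = D.gen R β (D.e x 2) := D.gen_eq_of_join R (.one12 x hβx)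
  have h30 : D.gen R β (D.e x 3) = D.gen R β (D.e x 0) := D.gen_eq_of_join R (.one30 x hβx)
  have hself := Submodule.mem_span_singleton_self (R := R)
    (D.gen R β (D.e x 0) - D.gen R β (D.e x 2))
  have hzero : ∀ {p q}, D.Join β p q → D.gen R β p - D.gen R β q ∈
      Submodule.span R {D.gen R β (D.e x 0) - D.gen R β (D.e x 2)} := fun h => by
    rw [D.gen_eq_of_join R h, sub_self]
    exact zero_mem _
  have hjoin : ∀ {p q}, D.Join α p q → D.gen R β p - D.gen R β q ∈
      Submodule.span R {D.gen R β (D.e x 0) - D.gen R β (D.e x 2)} := by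
    intro p q h
    cases h with
    | glue h => exact hzero (.glue h)
    | zero01 y h =>
      by_cases hy : y = x
      · subst hy
        rwa [h12]
      · exact hzero (.zero01 y (by simp [hβ, hy, h]))
    | zero23 y h =>
      by_cases hy : y = x
      · subst hy
        rw [h30, ← neg_mem_iff, neg_sub]
        exact hself
      · exact hzero (.zero23 y (by simp [hβ, hy, h]))
    | one12 y h =>
      by_cases hy : y = x
      · subst hy
        exact hzero (.one12 y hβx)
      · exact hzero (.one12 y (by simp [hβ, hy, h]))
    | one30 y h =>
      by_cases hy : y = x
      · subst hy
        exact hzero (.one30 y hβx)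
      · exact hzero (.one30 y (by simp [hβ, hy, h]))
  replace h := Quot.eqvGen_exact h
  induction h with
  | rel p q h => exact hjoin h
  | refl p =>
    rw [sub_self]
    exact zero_mem _
  | symm p q _ ih =>
    rw [← neg_mem_iff, neg_sub]
    exact ih
  | trans p q r _ _ ih ih' =>
    simpa only [sub_add_sub_cancel] using add_mem ih ih'

/-- `transfer` follows an arbitrary representative of the circle, not `p` itself; the scalar `c`
measures the discrepancy. -/
theorem exists_transferMap_gen (α : D.Resolution) (x : D.Crossing) (p : D.Pt) :
    ∃ c : R, D.transferMap R α (Function.update α x true) (ι R (D.gen R α p)) =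
      ι R (D.gen R (Function.update α x true) p) +
        c • ι R (D.gen R (Function.update α x true) (D.e x 0) -
          D.gen R (Function.update α x true) (D.e x 2)) := by
  have h : D.circleOf α (Quot.out (D.circleOf α p)) = D.circleOf α p := Quot.out_eq _
  obtain ⟨c, hc⟩ := Submodule.mem_span_singleton.1 (D.gen_sub_gen_mem_span R (x := x) h)
  refine ⟨c, ?_⟩
  rw [← map_smul, hc, ← map_add, add_sub_cancel, transferMap, map_apply_ι]
  simp [gen, transfer]

variable {D} in
theorem IsClosed.transferMap_gen (hD : D.IsClosed) {α : D.Resolution} {x : D.Crossing}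
    (hx : α x = false) (h : ¬ D.IsSplit α x) (p : D.Pt) :
    D.transferMap R α (Function.update α x true) (ι R (D.gen R α p)) =
      ι R (D.gen R (Function.update α x true) p) := by
  obtain ⟨c, hc⟩ := D.exists_transferMap_gen R α x p
  rw [hc, gen, gen, gen, hD.circleOf_eq_of_not_isSplit hx h, sub_self, map_zero, smul_zero,
    add_zero]

variable {D} in
theorem IsClosed.transferMap_gen_eq (hD : D.IsClosed) {α : D.Resolution} {x : D.Crossing}
    (hx : α x = false) (h : ¬ D.IsSplit α x) :
    D.transferMap R α (Function.update α x true) (ι R (D.gen R α (D.e x 0))) =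
      D.transferMap R α (Function.update α x true) (ι R (D.gen R α (D.e x 2))) := by
  rw [hD.transferMap_gen R hx h, hD.transferMap_gen R hx h, gen, gen,
    hD.circleOf_eq_of_not_isSplit hx h]

theorem edgeMap_of_not_isSplit {α : D.Resolution} {x : D.Crossing} (h : ¬ D.IsSplit α x)
    (β : D.Resolution) : D.edgeMap R x α β = (D.transferMap R α β).toLinearMap :=
  if_neg h

variable {D} in
-- For a merge the edge map is an algebra map sending the generator at `p` to the generator at `p`.
-- For a split the discrepancy is a multiple of the vector by which the edge map multiplies, so it
-- wedges to zero.
theorem IsClosed.edgeMap_mul_gen (hD : D.IsClosed) {α : D.Resolution} {x : D.Crossing}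
    (hx : α x = false) (p : D.Pt) (a : D.Ext R α) :
    D.edgeMap R x α (Function.update α x true) (a * ι R (D.gen R α p)) =
      D.edgeMap R x α (Function.update α x true) a *
        ι R (D.gen R (Function.update α x true) p) := by
  by_cases h : D.IsSplit α x
  · obtain ⟨c, hc⟩ := D.exists_transferMap_gen R α x p
    simp only [edgeMap, if_pos h, LinearMap.comp_apply, AlgHom.toLinearMap_apply,
      LinearMap.mulLeft_apply, map_mul, hc]
    rw [mul_add, mul_add, mul_smul_comm, mul_smul_comm, ← mul_assoc (ι R _) _ (ι R (_ - _)),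
      ι_mul_mul_ι, smul_zero, add_zero, mul_assoc]
  · simp only [edgeMap, if_neg h, AlgHom.toLinearMap_apply, map_mul, hD.transferMap_gen R hx h]

theorem aug_comp_transfer (α β : D.Resolution) :
    D.aug R β ∘ₗ Finsupp.lmapDomain R R (D.transfer α β) = D.aug R α := by
  ext c
  simp [aug]

theorem contractR_edgeMap (x : D.Crossing) (α β : D.Resolution) (a : D.Ext R α) :
    contractR (D.aug R β) (D.edgeMap R x α β a) =
      D.edgeMap R x α β (contractR (D.aug R α) a) := by
  have h1 : contractR (D.aug R β) (D.transferMap R α β a) =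
      D.transferMap R α β (contractR (D.aug R α) a) := by
    rw [transferMap, contractR_map, aug_comp_transfer]
  by_cases h : D.IsSplit α x
  · simp only [edgeMap, if_pos h, LinearMap.comp_apply, AlgHom.toLinearMap_apply,
      LinearMap.mulLeft_apply]
    rw [contractR_ι_mul (by rw [map_sub, aug_gen, aug_gen, sub_self]), h1]
  · simpa only [edgeMap, if_neg h, AlgHom.toLinearMap_apply] using h1

/-! ### The differential -/

variable (ε : D.Resolution → D.Crossing → ℤˣ)

theorem diff_apply (ω : D.Chain R) (β : D.Resolution) :
    D.diff R ε ω β = ∑ x, if β x = true then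
      ((ε (Function.update β x false) x : ℤˣ) : ℤ) •
        D.edgeMap R x (Function.update β x false) β (ω (Function.update β x false)) else 0 := by
  simp only [diff, LinearMap.pi_apply, LinearMap.sum_apply]
  refine Finset.sum_congr rfl fun x _ => ?_
  split_ifs <;> simp

/-- An operator on chains acting on vertices and commuting with the edge maps commutes with the
differential. -/
theorem diff_comm (T : D.Chain R →ₗ[R] D.Chain R) (t : ∀ α, D.Ext R α →ₗ[R] D.Ext R α)
    (hT : ∀ ω α, T ω α = t α (ω α))
    (h : ∀ (α : D.Resolution) (x : D.Crossing) (a : D.Ext R α), α x = false →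
      t _ (D.edgeMap R x α (Function.update α x true) a) =
        D.edgeMap R x α (Function.update α x true) (t α a)) (ω : D.Chain R) :
    T (D.diff R ε ω) = D.diff R ε (T ω) := by
  funext β
  rw [hT, diff_apply, diff_apply, map_sum]
  refine Finset.sum_congr rfl fun x _ => ?_
  split_ifs with hβ
  · have h1 := h (Function.update β x false) x (ω _) (by simp)
    have h2 : Function.update (Function.update β x false) x true = β := by simp [← hβ]
    rw [h2] at h1
    rw [map_zsmul, h1, hT]
  · exact map_zero _

theorem contractAug_diff (ω : D.Chain R) :
    D.contractAug R (D.diff R ε ω) = D.diff R ε (D.contractAug R ω) :=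
  D.diff_comm R ε (D.contractAug R) (fun α => contractR (D.aug R α)) (fun _ _ => rfl)
    (fun _ _ _ _ => D.contractR_edgeMap R _ _ _ _) ω

variable {D} in
theorem IsClosed.wedge_diff (hD : D.IsClosed) (q : D.Pt) (ω : D.Chain R) :
    D.wedge R q (D.diff R ε ω) = D.diff R ε (D.wedge R q ω) :=
  D.diff_comm R ε (D.wedge R q) (fun α => LinearMap.mulRight R (ι R (D.gen R α q)))
    (fun _ _ => rfl) (fun _ _ _ hx => (hD.edgeMap_mul_gen R hx _ _).symm) ω

/-- The point `q` supplies, at every vertex, a vector of augmentation 1. -/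
theorem mem_reduced_iff (q : D.Pt) {ω : D.Chain R} :
    ω ∈ D.reduced R ↔ D.contractAug R ω = 0 := by
  rw [reduced, Submodule.mem_pi, funext_iff]
  exact forall_congr' fun α => ⟨fun h => (mem_kerExt_iff (D.aug_gen R α q)).1 (h trivial),
    fun h _ => (mem_kerExt_iff (D.aug_gen R α q)).2 h⟩

theorem diff_mem_reduced (q : D.Pt) {ω : D.Chain R} (h : ω ∈ D.reduced R) :
    D.diff R ε ω ∈ D.reduced R := by
  rw [D.mem_reduced_iff R q] at h ⊢
  rw [contractAug_diff, h, map_zero]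

variable {D ε} in
theorem IsSignAssignment.diff_diff (hε : D.IsSignAssignment R ε) (ω : D.Chain R) :
    D.diff R ε (D.diff R ε ω) = 0 := by
  funext γ
  -- The term of the pair `(y, x)` is the path into `γ` whose first edge changes `x` and whose last
  -- edge changes `y`.
  let T : D.Crossing × D.Crossing → D.Ext R γ := fun p =>
    if γ p.1 = true then if Function.update γ p.1 false p.2 = true then
      ((ε (Function.update γ p.1 false) p.1 : ℤˣ) : ℤ) •
        D.edgeMap R p.1 (Function.update γ p.1 false) γ
          (((ε (Function.update (Function.update γ p.1 false) p.2 false) p.2 : ℤˣ) : ℤ) •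
            D.edgeMap R p.2 (Function.update (Function.update γ p.1 false) p.2 false)
              (Function.update γ p.1 false)
              (ω (Function.update (Function.update γ p.1 false) p.2 false)))
      else 0 else 0
  have hT : D.diff R ε (D.diff R ε ω) γ = ∑ p, T p := by
    rw [diff_apply, Fintype.sum_prod_type]
    refine Finset.sum_congr rfl fun y _ => ?_
    split_ifs with hy
    · rw [diff_apply, map_sum, Finset.smul_sum]
      refine Finset.sum_congr rfl fun x _ => ?_
      simp only [T, if_pos hy]
      split_ifs <;> simp
    · simp [T, hy]
  have hdiag : ∀ x, T (x, x) = 0 := fun x => by simp [T]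
  have hswap : ∀ p, T p + T p.swap = 0 := by
    rintro ⟨y, x⟩
    by_cases hxy : x = y
    · subst hxy
      simp [hdiag]
    by_cases hx : γ x = true
    swap
    · simp [T, hx, hxy]
    by_cases hy : γ y = true
    swap
    · simp [T, hy, Ne.symm hxy]
    have hc := Function.update_comm hxy false false γ
    -- Skewness is applied at the initial vertex of the face, where both `x` and `y` are set to `0`;
    -- its opposite corner is `γ`.
    have key := hε.skew (Function.update (Function.update γ y false) x false) x y hxy
      (by simp) (by simp [Ne.symm hxy])
    have e1 : Function.update (Function.update (Function.update γ y false) x false) x true =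
        Function.update γ y false := by
      rw [Function.update_idem, Function.update_eq_self_iff]
      simp [hxy, hx]
    have e2 : Function.update (Function.update (Function.update γ y false) x false) y true =
        Function.update γ x false := by
      rw [← hc, Function.update_idem, Function.update_eq_self_iff]
      simp [Ne.symm hxy, hy]
    have e3 : Function.update (Function.update γ y false) y true = γ := by
      simp [← hy]
    rw [e1, e2, e3] at key
    have key2 := LinearMap.congr_fun key
      (ω (Function.update (Function.update γ y false) x false))
    simp only [LinearMap.add_apply, LinearMap.smul_apply, LinearMap.comp_apply,
      LinearMap.zero_apply, Units.val_mul] at key2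
    simp only [T, Prod.swap, hx, hy, Function.update_of_ne hxy, Function.update_of_ne (Ne.symm hxy),
      if_true, map_zsmul, hc, smul_smul]
    rw [hc, ← key2, mul_comm, mul_comm (Units.val (ε (Function.update γ x false) x))]
  rw [hT]
  -- The two paths around a face cancel; the fixed points of the swap are diagonal terms, which
  -- vanish because a crossing cannot be changed twice.
  refine Finset.sum_involution (fun p _ => p.swap) (fun p _ => hswap p) ?_
    (fun _ _ => Finset.mem_univ _) fun p _ => p.swap_swap
  rintro ⟨y, x⟩ - h0 h1
  obtain rfl : x = y := congrArg Prod.fst h1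
  exact h0 (hdiag x)

theorem diff_single {α : D.Resolution} {a : D.Ext R α}
    (h : ∀ x, α x = false → D.edgeMap R x α (Function.update α x true) a = 0) :
    D.diff R ε (Pi.single α a) = 0 := by
  funext β
  rw [diff_apply]
  refine Finset.sum_eq_zero fun x _ => ?_
  split_ifs with hβ
  · by_cases hα : Function.update β x false = α
    · subst hα
      have h1 := h x (by simp)
      have h2 : Function.update (Function.update β x false) x true = β := by simp [← hβ]
      rw [h2] at h1
      rw [Pi.single_eq_same, h1, smul_zero]
    · rw [Pi.single_eq_of_ne hα, map_zero, smul_zero]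
  · rfl

/-! ### The splitting -/

theorem contractAug_wedge (q : D.Pt) (ω : D.Chain R) :
    D.contractAug R (D.wedge R q ω) = ω - D.wedge R q (D.contractAug R ω) := by
  funext α
  refine (contractR_mul_ι (D.aug R α) (ω α) (D.gen R α q)).trans ?_
  rw [aug_gen, one_smul]
  rfl

theorem aug_comp_inclV (α : D.Resolution) : D.addCircle.aug R α ∘ₗ D.inclV R α = D.aug R α := by
  ext c
  simp [aug, inclV]

theorem contractAug_inclChain (ω : D.Chain R) :
    D.addCircle.contractAug R (D.inclChain R ω) = D.inclChain R (D.contractAug R ω) := by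
  funext α
  refine (contractR_map (D.inclV R α) (D.addCircle.aug R α) (ω α)).trans ?_
  rw [aug_comp_inclV]
  rfl

theorem wedge_inclChain (q : D.Pt) (ω : D.Chain R) :
    D.addCircle.wedge R (some q) (D.inclChain R ω) = D.inclChain R (D.wedge R q ω) := by
  funext α
  refine Eq.trans ?_ (map_mul (map (D.inclV R α)) (ω α) (ι R (D.gen R α q))).symm
  rw [map_apply_ι, inclV_gen]
  rfl

theorem wedge_comm (p q : D.Pt) (ω : D.Chain R) :
    D.wedge R p (D.wedge R q ω) = -D.wedge R q (D.wedge R p ω) := by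
  funext α
  have h : ι R (D.gen R α q) * ι R (D.gen R α p) = -(ι R (D.gen R α p) * ι R (D.gen R α q)) :=
    eq_neg_of_add_eq_zero_left (ι_add_mul_swap (R := R) _ _)
  refine (mul_assoc (ω α) _ _).trans ?_
  rw [h, mul_neg, ← mul_assoc]
  rfl

theorem coe_Phi1 (ω : D.Chain R) :
    (D.Phi1 R ω : D.addCircle.Chain R) = D.addCircle.wedge R none (D.inclChain R ω) := rfl

theorem coe_Phi2 (q : D.Pt) (z : D.addCircle.pointed R none) :
    (D.Phi2 R q z : D.addCircle.Chain R) =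
      D.addCircle.wedge R (some q) (D.addCircle.contractAug R z.1) := rfl

/-- Contracting `ω ∧ v₀` gives `ω - (ω⌊φ) ∧ v₀`. After wedging with `v_q`, moving `v₀` back to the
right end turns the minus sign into a plus, which is the form `Φ₃` reads off. -/
theorem coe_Phi2_Phi1 (q : D.Pt) (ω : D.Chain R) :
    (D.Phi2 R q (D.Phi1 R ω) : D.addCircle.Chain R) = D.inclChain R (D.wedge R q ω) +
      D.addCircle.wedge R none (D.inclChain R (D.wedge R q (D.contractAug R ω))) := by
  rw [coe_Phi2, coe_Phi1, contractAug_wedge, contractAug_inclChain, map_sub, wedge_inclChain,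
    wedge_comm, wedge_inclChain, sub_neg_eq_add]

theorem coe_Phi_fst (q : D.Pt) (ω : D.Chain R) :
    ((D.Phi R q ω).1 : D.Chain R) = D.contractAug R (D.wedge R q ω) := by
  change D.contractAug R (D.projChain R (D.Phi2 R q (D.Phi1 R ω)).1) = _
  rw [coe_Phi2_Phi1, map_add, projChain_incl, projChain_wedge, add_zero]

theorem coe_Phi_snd (q : D.Pt) (ω : D.Chain R) :
    ((D.Phi R q ω).2 : D.Chain R) = D.contractAug R ω := by
  change D.contractAug R (D.coordChain R (D.Phi2 R q (D.Phi1 R ω)).1) = _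
  rw [coe_Phi2_Phi1, map_add, coordChain_incl, coordChain_wedge, zero_add, contractAug_wedge]
  have h : D.contractAug R (D.contractAug R ω) = 0 := funext fun α => contractR_contractR _ _
  rw [h, map_zero, sub_zero]

theorem Phi_symm_zero_left (q : D.Pt) (z : D.reduced R) :
    (D.Phi R q).symm (0, z) = D.wedge R q z := by
  have hz := (D.mem_reduced_iff R q).1 z.2
  rw [LinearEquiv.symm_apply_eq]
  refine Prod.ext (Subtype.ext ?_) (Subtype.ext ?_)
  · rw [coe_Phi_fst, wedge_wedge, map_zero]
    rfl
  · rw [coe_Phi_snd, contractAug_wedge, hz, map_zero, sub_zero]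

/-! ### The inclusion of reduced into unreduced homology -/

theorem redBigraded_le_reduced (r s : ℤ) : D.redBigraded R r s ≤ D.reduced R :=
  Submodule.pi_mono fun _ _ => iSup_le fun _ => kerPower_le_kerExt _ _

theorem wedge_mem_bigraded (q : D.Pt) {r s : ℤ} {z : D.Chain R}
    (hz : z ∈ D.redBigraded R r (s + 1)) : D.wedge R q z ∈ D.bigraded R r s := by
  intro α hα
  suffices h : _ ≤ Submodule.comap (LinearMap.mulRight R (ι R (D.gen R α q)))
      (⨆ k : {k : ℕ // D.hDegree α = r ∧ D.qDegree α (Nat.card (D.Circle α)) k = s},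
        ⋀[R]^k.1 (D.V R α)) from h (hz α hα)
  refine iSup_le fun k x hx => ?_
  -- Passing from `ker φ` to `V` raises the rank by 1, and raising `k` by 1 lowers `Q` by 2: in
  -- total `Q` drops by 1.
  refine Submodule.mem_iSup_of_mem ⟨k.1 + 1, k.2.1, ?_⟩ (mul_ι_mem_exteriorPower hx _)
  have h := k.2.2
  rw [qDegree] at h ⊢
  push_cast
  linarith

theorem contractAug_mem_redBigraded (q : D.Pt) {r s : ℤ} {z : D.Chain R}
    (hz : z ∈ D.bigraded R r s) : D.contractAug R z ∈ D.redBigraded R r (s + 1) := by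
  intro α hα
  suffices h : _ ≤ Submodule.comap (contractR (D.aug R α))
      (⨆ k : {k : ℕ // D.hDegree α = r ∧
        D.qDegree α ((Nat.card (D.Circle α) : ℤ) - 1) k = s + 1},
        kerPower (D.aug R α) k.1) from h (hz α hα)
  refine iSup_le fun k x hx => ?_
  obtain ⟨k, h1, h2⟩ := k
  have h3 := (contractR_mem_kerPowerPred (D.aug_gen R α q) hx).2
  -- In exterior degree 0 the contraction vanishes, so no target degree `k - 1` is required.
  cases k with
  | zero =>
    rw [Submodule.mem_comap, (Submodule.mem_bot R).1 h3]
    exact zero_mem _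
  | succ k =>
    refine Submodule.mem_iSup_of_mem ⟨k, h1, ?_⟩ h3
    rw [qDegree] at h2 ⊢
    push_cast at h2
    linarith

variable {D}

theorem IsClosed.wedge_mem_cycles (hD : D.IsClosed) (q : D.Pt) {r s : ℤ} {z : D.Chain R}
    (hz : z ∈ D.redCycles R ε r (s + 1)) : D.wedge R q z ∈ D.cycles R ε r s :=
  ⟨LinearMap.mem_ker.2 (by rw [← hD.wedge_diff R, LinearMap.mem_ker.1 hz.1, map_zero]),
    D.wedge_mem_bigraded R q hz.2⟩

/-- The map `z ↦ z ∧ v_q` from reduced to unreduced homology. -/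
def IsClosed.wedgeHomology (hD : D.IsClosed) (q : D.Pt) (r s : ℤ) :
    D.RedKh R ε r (s + 1) →ₗ[R] D.Kh R ε r s :=
  Submodule.mapQ _ _ ((D.wedge R q).restrict fun _ => hD.wedge_mem_cycles R ε q) <| by
    rintro ⟨_, hz⟩ ⟨η, hη, rfl⟩
    exact ⟨D.wedge R q η, D.wedge_mem_bigraded R q hη, (hD.wedge_diff R ε q η).symm⟩

theorem IsClosed.wedgeHomology_redKhClass (hD : D.IsClosed) (q : D.Pt) {r s : ℤ} {z : D.Chain R}
    (hz : z ∈ D.redCycles R ε r (s + 1)) :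
    hD.wedgeHomology R ε q r s (D.redKhClass R ε z hz) =
      D.khClass R ε (D.wedge R q z) (hD.wedge_mem_cycles R ε q hz) := rfl

/-- If `z ∧ v_q = dη` with `z` reduced, contracting both sides gives `z = d(η⌊φ)`, and `η⌊φ` is a
reduced chain of the right bidegree. -/
theorem IsClosed.wedgeHomology_injective (hD : D.IsClosed) (q : D.Pt) (r s : ℤ) :
    Function.Injective (hD.wedgeHomology R ε q r s) := by
  rw [injective_iff_map_eq_zero]
  intro c hc
  obtain ⟨⟨z, hz⟩, rfl⟩ := Submodule.Quotient.mk_surjective _ c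
  obtain ⟨η, hη, h⟩ := (Submodule.Quotient.mk_eq_zero _).1 hc
  refine (Submodule.Quotient.mk_eq_zero _).2
    ⟨D.contractAug R η, D.contractAug_mem_redBigraded R q hη, ?_⟩
  have hz0 := (D.mem_reduced_iff R q).1 (D.redBigraded_le_reduced R _ _ hz.2)
  have h' : D.diff R ε η = D.wedge R q z := h
  rw [← contractAug_diff, h', contractAug_wedge, hz0, map_zero, sub_zero]
  rfl

end

end LinkDiagram

/-! ### Closed braids: parity, the oriented resolution, the invariants -/

namespace BraidWord

variable {m : ℕ} (w : BraidWord m) (o : Fin w.length → Bool)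

theorem castSucc_ne_succ_letter (k : Fin w.length) :
    (w.get k).1.castSucc ≠ (w.get k).1.succ :=
  (Fin.castSucc_lt_succ).ne

/-- The crossing sign and the arrow only rotate the numbering of the four corners, which a sum over
all corners does not see. -/
theorem sum_corner (f : Fin (w.length + 1) × Fin (m + 1) → ZMod 2) (k : Fin w.length) :
    ∑ j, f ((w.closure o).e k j) = ∑ j, f (w.corner k j) := by
  have h : ∀ c : Fin 4, ∑ j, f (w.corner k (j + c)) = ∑ j, f (w.corner k j) := fun c =>
    Equiv.sum_comp (Equiv.addRight c) fun j => f (w.corner k j)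
  simp only [closure, add_assoc]
  exact h _

/-- Between two consecutive levels, a function constant on the strands not at the crossing has
the same sum mod 2 at both levels, up to its values at the four points around the crossing. -/
theorem sum_levels (f : Fin (w.length + 1) × Fin (m + 1) → ZMod 2)
    (hf : ∀ p q, (w.closure o).glue p q → f p = f q) (k : Fin w.length) :
    ∑ j, f ((w.closure o).e k j) = ∑ j, f (k.castSucc, j) + ∑ j, f (k.succ, j) := by
  rw [sum_corner, ← Finset.sum_add_distrib, Fin.sum_univ_four,
    Finset.sum_eq_add_of_mem (w.get k).1.castSucc (w.get k).1.succ (Finset.mem_univ _)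
      (Finset.mem_univ _) (w.castSucc_ne_succ_letter k)]
  · simp only [corner, Matrix.cons_val]
    ring
  · intro j _ hj
    rw [hf (k.castSucc, j) (k.succ, j) (Or.inr ⟨k, j, hj.1, hj.2, rfl, rfl⟩),
      CharTwo.add_self_eq_zero]

/-- Mod 2, the corner sum at a crossing is the sum of the totals at the levels just below and above
it. Over all crossings this telescopes to bottom plus top, which cancel because the closure glues
them. -/
theorem isClosed_closure : (w.closure o).IsClosed := by
  intro f x hf hsum
  let F : Fin (w.length + 1) → ZMod 2 := fun k => ∑ j, f (k, j)
  have hlev : ∀ k : Fin w.length, ∑ j, f ((w.closure o).e k j) = F k.castSucc + F k.succ :=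
    w.sum_levels o f hf
  have htot : ∑ k : Fin w.length, (F k.castSucc + F k.succ) = F 0 + F (Fin.last _) := by
    rw [Finset.sum_add_distrib]
    have h1 := Fin.sum_univ_succ F
    have h2 := Fin.sum_univ_castSucc F
    have h3 : ∑ k : Fin w.length, F k.succ = ∑ k, F k - F 0 := by rw [h1]; ring
    have h4 : ∑ k : Fin w.length, F k.castSucc = ∑ k, F k - F (Fin.last _) := by rw [h2]; ring
    rw [h3, h4]
    simp only [CharTwo.sub_eq_add]
    linear_combination CharTwo.add_self_eq_zero (∑ k, F k)
  have hends : F 0 = F (Fin.last _) :=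
    Finset.sum_congr rfl fun j _ => hf (0, j) (Fin.last _, j) (Or.inl ⟨j, rfl, rfl⟩)
  rw [hends, CharTwo.add_self_eq_zero] at htot
  -- All crossings other than `x` contribute zero, so the vanishing total is the corner sum at `x`.
  refine (hlev x).trans (Eq.trans (Eq.symm ?_) htot)
  exact Finset.sum_eq_single (M := ZMod 2) (ι := Fin w.length) x
    (fun y _ hy => (hlev y).symm.trans (hsum y hy)) fun h => (h (Finset.mem_univ _)).elim

/-! ### The resolution into parallel strands -/

theorem braidResolution_apply (k : Fin w.length) :
    w.braidResolution o k = !(w.get k).2 := rfl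

/-- The points joined in the oriented resolution lie on the same strand. -/
theorem snd_eq_of_join {p q : (w.closure o).Pt}
    (h : (w.closure o).Join (w.braidResolution o) p q) : p.2 = q.2 := by
  cases h with
  | glue h =>
    obtain ⟨j, rfl, rfl⟩ | ⟨k, j, -, -, rfl, rfl⟩ := h <;> rfl
  | zero01 k h | zero23 k h =>
    have h' : (w.get k).2 = true := Eq.mp (Bool.not_eq_false' _) h
    simp only [closure, h']
    cases o k <;> rfl
  | one12 k h | one30 k h =>
    have h' : (w.get k).2 = false := Eq.mp (Bool.not_eq_true' _) h
    simp only [closure, h']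
    cases o k <;> rfl

/-- At the two positions of the crossing the vertical arcs of the oriented smoothing join the
levels; the sign and the arrow decide which of the joins is the left one. Elsewhere the strand
passes straight through. -/
theorem join_levels (k : Fin w.length) (j : Fin (m + 1)) :
    (w.closure o).circleOf (w.braidResolution o)
        ((k.succ, j) : Fin (w.length + 1) × Fin (m + 1)) =
      (w.closure o).circleOf (w.braidResolution o)
        ((k.castSucc, j) : Fin (w.length + 1) × Fin (m + 1)) := by
  by_cases h1 : j = (w.get k).1.castSucc ∨ j = (w.get k).1.succ
  · cases hk : (w.get k).2 <;> cases ho : o k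
    · have hα : w.braidResolution o k = true := by rw [braidResolution_apply, hk]; rfl
      have a := Quot.sound (LinkDiagram.Join.one30 (D := w.closure o) k hα)
      have b := Quot.sound (LinkDiagram.Join.one12 (D := w.closure o) k hα)
      simp only [closure, hk, ho] at a b
      rcases h1 with rfl | rfl
      · exact a
      · exact b.symm
    · have hα : w.braidResolution o k = true := by rw [braidResolution_apply, hk]; rfl
      have a := Quot.sound (LinkDiagram.Join.one30 (D := w.closure o) k hα)
      have b := Quot.sound (LinkDiagram.Join.one12 (D := w.closure o) k hα)
      simp only [closure, hk, ho] at a b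
      rcases h1 with rfl | rfl
      · exact b
      · exact a.symm
    · have hα : w.braidResolution o k = false := by rw [braidResolution_apply, hk]; rfl
      have a := Quot.sound (LinkDiagram.Join.zero01 (D := w.closure o) k hα)
      have b := Quot.sound (LinkDiagram.Join.zero23 (D := w.closure o) k hα)
      simp only [closure, hk, ho] at a b
      rcases h1 with rfl | rfl
      · exact a
      · exact b.symm
    · have hα : w.braidResolution o k = false := by rw [braidResolution_apply, hk]; rfl
      have a := Quot.sound (LinkDiagram.Join.zero01 (D := w.closure o) k hα)
      have b := Quot.sound (LinkDiagram.Join.zero23 (D := w.closure o) k hα)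
      simp only [closure, hk, ho] at a b
      rcases h1 with rfl | rfl
      · exact b
      · exact a.symm
  · rw [not_or] at h1
    exact (Quot.sound (.glue (Or.inr ⟨k, j, h1.1, h1.2, rfl, rfl⟩))).symm

theorem circleOf_braidResolution (p : Fin (w.length + 1) × Fin (m + 1)) :
    (w.closure o).circleOf (w.braidResolution o) p =
      (w.closure o).circleOf (w.braidResolution o)
        ((0, p.2) : Fin (w.length + 1) × Fin (m + 1)) := by
  obtain ⟨k, j⟩ := p
  induction k using Fin.induction with
  | zero => rfl
  | succ k ih => exact (w.join_levels o k j).trans ih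

/-- The circles of the oriented resolution are the closures of the strands. -/
def circleEquiv : (w.closure o).Circle (w.braidResolution o) ≃ Fin (m + 1) where
  toFun := Quot.lift (fun p => p.2) fun _ _ => w.snd_eq_of_join o
  invFun j := (w.closure o).circleOf (w.braidResolution o)
    ((0, j) : Fin (w.length + 1) × Fin (m + 1))
  left_inv c := by
    induction c using Quot.ind with
    | mk p => exact (w.circleOf_braidResolution o p).symm
  right_inv _ := rfl

theorem card_circle : Nat.card ((w.closure o).Circle (w.braidResolution o)) = m + 1 := by
  rw [Nat.card_congr (w.circleEquiv o), Nat.card_fin]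

theorem card_filter_get {T : Type*} (p : T → Bool) (l : List T) :
    (Finset.univ.filter fun k : Fin l.length => p (l.get k) = true).card = l.countP p := by
  induction l with
  | nil => rfl
  | cons a l ih =>
    rw [List.countP_cons, ← ih]
    refine (Fin.card_filter_univ_succ (n := l.length) _).trans ?_
    simp only [List.get_eq_getElem, Fin.val_zero, List.getElem_cons_zero,
      Fin.val_succ, List.getElem_cons_succ]
    split_ifs <;> simp

theorem nPos_closure : (w.closure o).nPos = w.countP fun l => l.2 :=
  card_filter_get (fun l : Fin m × Bool => l.2) w

theorem nNeg_closure : (w.closure o).nNeg = w.countP fun l => !l.2 := by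
  rw [← card_filter_get (fun l : Fin m × Bool => !l.2) w]
  exact congrArg Finset.card (Finset.filter_congr fun k _ => Iff.of_eq (Bool.not_eq_true' _).symm)

theorem len_braidResolution : (w.closure o).len (w.braidResolution o) = (w.closure o).nNeg := by
  refine congrArg Finset.card (Finset.filter_congr fun k _ => ?_)
  simp [braidResolution]

theorem hDegree_braidResolution : (w.closure o).hDegree (w.braidResolution o) = 0 := by
  rw [LinkDiagram.hDegree, len_braidResolution, sub_self]

/-- At this vertex `|α| = n₋`, so the shift `n₊ - 2n₋ + |α|` becomes `n₊ - n₋`. -/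
theorem qDegree_braidResolution (d : ℤ) (k : ℕ) (h : d - 2 * k = -m - 1) :
    (w.closure o).qDegree (w.braidResolution o) d k = w.sl := by
  rw [LinkDiagram.qDegree, len_braidResolution, nPos_closure, nNeg_closure, sl]
  linarith

variable (R : Type*) [CommRing R]

theorem gen_braidResolution (p : Fin (w.length + 1) × Fin (m + 1)) :
    (w.closure o).gen R (w.braidResolution o) p = w.strand o R p.2 :=
  congrArg (fun c => Finsupp.single c 1) (w.circleOf_braidResolution o p)

theorem aug_strand_sub (i j : Fin (m + 1)) :
    (w.closure o).aug R (w.braidResolution o) (w.strand o R i - w.strand o R j) = 0 := by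
  rw [map_sub, sub_eq_zero]
  exact ((w.closure o).aug_gen R _ _).trans ((w.closure o).aug_gen R _ _).symm

theorem redPsi_mem_redBigraded :
    w.redPsi o R ∈ (w.closure o).redBigraded R 0 (w.sl + 1) := by
  intro α _
  by_cases h : α = w.braidResolution o
  · subst h
    rw [redPsi, Pi.single_eq_same]
    refine Submodule.mem_iSup_of_mem ⟨m, w.hDegree_braidResolution o, ?_⟩
      (ιMulti_mem_kerPower fun j => w.aug_strand_sub o R _ _)
    -- The value `d = m - 1` is auxiliary, chosen to give `sl`; the actual rank of the kernel is
    -- `m`, whence `sl + 1`.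
    rw [← w.qDegree_braidResolution o (m - 1) m (by ring), card_circle, LinkDiagram.qDegree,
      LinkDiagram.qDegree]
    push_cast
    ring
  · rw [redPsi, Pi.single_eq_of_ne h]
    exact zero_mem _

/-- The edges leaving the oriented resolution merge two neighbouring strands. -/
theorem edgeMap_braidResolution {k : Fin w.length} (hk : w.braidResolution o k = false)
    (a : (w.closure o).Ext R (w.braidResolution o)) :
    (w.closure o).edgeMap R k (w.braidResolution o)
        (Function.update (w.braidResolution o) k true) a =
      (w.closure o).transferMap R (w.braidResolution o)
        (Function.update (w.braidResolution o) k true) a ∧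
    (w.closure o).transferMap R (w.braidResolution o)
        (Function.update (w.braidResolution o) k true)
        (ExteriorAlgebra.ι R (w.strand o R (w.get k).1.castSucc)) =
      (w.closure o).transferMap R (w.braidResolution o)
        (Function.update (w.braidResolution o) k true)
        (ExteriorAlgebra.ι R (w.strand o R (w.get k).1.succ)) := by
  have hpos : (w.get k).2 = true := Eq.mp (Bool.not_eq_false' _) hk
  have hcol : ((w.closure o).e k 0).2 = (w.get k).1.castSucc ∧
      ((w.closure o).e k 2).2 = (w.get k).1.succ ∨
      ((w.closure o).e k 0).2 = (w.get k).1.succ ∧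
      ((w.closure o).e k 2).2 = (w.get k).1.castSucc := by
    simp only [closure, hpos]
    cases o k
    · exact Or.inl ⟨rfl, rfl⟩
    · exact Or.inr ⟨rfl, rfl⟩
  -- The arrow joins neighbouring positions, and distinct positions are distinct circles of this
  -- resolution.
  have hsplit : ¬ (w.closure o).IsSplit (w.braidResolution o) k := fun h => by
    have h' : ((w.closure o).e k 0).2 = ((w.closure o).e k 2).2 :=
      congrArg (w.circleEquiv o) h
    rcases hcol with ⟨h1, h2⟩ | ⟨h1, h2⟩ <;> rw [h1, h2] at h'
    · exact w.castSucc_ne_succ_letter k h'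
    · exact w.castSucc_ne_succ_letter k h'.symm
  refine ⟨LinearMap.congr_fun ((w.closure o).edgeMap_of_not_isSplit R hsplit _) a, ?_⟩
  have h := (w.isClosed_closure o).transferMap_gen_eq R hk hsplit
  have g0 := w.gen_braidResolution o R ((w.closure o).e k 0)
  have g2 := w.gen_braidResolution o R ((w.closure o).e k 2)
  rw [g0, g2] at h
  rcases hcol with ⟨h1, h2⟩ | ⟨h1, h2⟩ <;> rw [h1, h2] at h
  · exact h
  · exact h.symm

variable (ε : (w.closure o).Resolution → (w.closure o).Crossing → ℤˣ)

theorem diff_redPsi : (w.closure o).diff R ε (w.redPsi o R) = 0 := by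
  refine (w.closure o).diff_single R ε fun k hk => ?_
  obtain ⟨h1, h2⟩ := w.edgeMap_braidResolution o R hk
    (ExteriorAlgebra.ιMulti R m fun j => w.strand o R j.castSucc - w.strand o R j.succ)
  rw [h1]
  rw [LinkDiagram.transferMap, ExteriorAlgebra.map_apply_ι, ExteriorAlgebra.map_apply_ι] at h2
  rw [LinkDiagram.transferMap, ExteriorAlgebra.map_apply_ιMulti]
  -- The factor indexed by the letter of the crossing is the difference of the two strands being
  -- merged.
  refine (ExteriorAlgebra.ιMulti R m).map_coord_zero (w.get k).1 ?_
  rw [Function.comp_apply, map_sub, sub_eq_zero]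
  exact (ExteriorAlgebra.ι_inj R _ _).1 h2

/-- Any point `q` will do: it lies on some strand, and each strand gives the same wedge. -/
theorem wedge_redPsi (q : (w.closure o).Pt) :
    (w.closure o).wedge R q (w.redPsi o R) = w.psi o R := by
  funext α
  change w.redPsi o R α * ExteriorAlgebra.ι R ((w.closure o).gen R α q) = _
  by_cases h : α = w.braidResolution o
  · subst h
    have g := w.gen_braidResolution o R q
    rw [redPsi, psi, Pi.single_eq_same, Pi.single_eq_same, g]
    exact ιMulti_sub_mul_ι _ _
  · rw [redPsi, psi, Pi.single_eq_of_ne h, Pi.single_eq_of_ne h, zero_mul]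

theorem redPsi_mem_redCycles : w.redPsi o R ∈ (w.closure o).redCycles R ε 0 (w.sl + 1) :=
  ⟨w.diff_redPsi o R ε, w.redPsi_mem_redBigraded o R⟩

end BraidWord

end OddKhovanov

/-! ### The proposition -/

theorem proposition3p9 {R : Type*} [CommRing R] {m : ℕ} (w : OddKhovanov.BraidWord m)
    (o : Fin w.length → Bool) (ε : (w.closure o).Resolution → (w.closure o).Crossing → ℤˣ)
    (hε : (w.closure o).IsSignAssignment R ε) (q : (w.closure o).Pt) :
    -- `Φ` is an isomorphism of complexes
    (w.closure o).diff R ε ∘ₗ (w.closure o).diff R ε = 0 ∧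
    (∀ ω : (w.closure o).reduced R, (w.closure o).diff R ε ω ∈ (w.closure o).reduced R) ∧
    (∀ ω : (w.closure o).Chain R,
      (((w.closure o).Phi R q ((w.closure o).diff R ε ω)).1 : (w.closure o).Chain R) =
          (w.closure o).diff R ε ((w.closure o).Phi R q ω).1 ∧
        (((w.closure o).Phi R q ((w.closure o).diff R ε ω)).2 : (w.closure o).Chain R) =
          (w.closure o).diff R ε ((w.closure o).Phi R q ω).2) ∧
    -- the inclusion `ι` induced by the inverse of `Φ` on the second summand
    ∃ ι : ∀ r s : ℤ, (w.closure o).RedKh R ε r (s + 1) →ₗ[R] (w.closure o).Kh R ε r s,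
      (∀ r s, Function.Injective (ι r s)) ∧
      (∀ (r s : ℤ) (z : (w.closure o).reduced R)
        (hz : (z : (w.closure o).Chain R) ∈ (w.closure o).redCycles R ε r (s + 1)),
        ∃ h : ((w.closure o).Phi R q).symm (0, z) ∈ (w.closure o).cycles R ε r s,
          ι r s ((w.closure o).redKhClass R ε z hz) = (w.closure o).khClass R ε _ h) ∧
      ∃ (hr : w.redPsi o R ∈ (w.closure o).redCycles R ε 0 (w.sl + 1))
        (hu : w.psi o R ∈ (w.closure o).cycles R ε 0 w.sl),
        ι 0 w.sl ((w.closure o).redKhClass R ε _ hr) = (w.closure o).khClass R ε _ hu ∨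
        ι 0 w.sl ((w.closure o).redKhClass R ε _ hr) = -(w.closure o).khClass R ε _ hu := by
  have hC := w.isClosed_closure o
  refine ⟨LinearMap.ext fun ω => hε.diff_diff R ω,
    fun ω => (w.closure o).diff_mem_reduced R ε q ω.2, fun ω => ⟨?_, ?_⟩,
    hC.wedgeHomology R ε q, hC.wedgeHomology_injective R ε q, fun r s z hz => ?_,
    w.redPsi_mem_redCycles o R ε, ?_⟩
  · rw [OddKhovanov.LinkDiagram.coe_Phi_fst, OddKhovanov.LinkDiagram.coe_Phi_fst, hC.wedge_diff R,
      OddKhovanov.LinkDiagram.contractAug_diff]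
  · rw [OddKhovanov.LinkDiagram.coe_Phi_snd, OddKhovanov.LinkDiagram.coe_Phi_snd,
      OddKhovanov.LinkDiagram.contractAug_diff]
  · simp only [OddKhovanov.LinkDiagram.Phi_symm_zero_left]
    exact ⟨hC.wedge_mem_cycles R ε q hz, rfl⟩
  · have h := hC.wedgeHomology_redKhClass R ε q (w.redPsi_mem_redCycles o R ε)
    have hu := hC.wedge_mem_cycles R ε q (w.redPsi_mem_redCycles o R ε)
    simp only [w.wedge_redPsi o R q] at h hu
    -- With the wedge on the right, the sign is always `+`.
    exact ⟨hu, Or.inl h⟩
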